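/- Let $\mathcal X$ be a nonempty set (the input alphabet, possibly infinite), $\mathcal Y$ a finite set (the output alphabet), and $W:x\mapsto W_x$ a channel, i.e. a map from $\mathcal X$ to the probability distributions on $\mathcal Y$. Let $\mathcal P(\mathcal X)$ be the set of (discrete) probability distributions on $\mathcal X$. For $p\in\mathcal P(\mathcal X)$ put $W_p(y)=\sum_x p(x)W_x(y)$; let $p^n$ be the $n$-fold i.i.d. distribution of $p$ on $\mathcal X^n$ and $W^n_{x}(y)=\prod_{i=1}^n W_{x_i}(y_i)$ the stationary memoryless channel from $\mathcal X^n$ to $\mathcal Y^n$. A resolvability code $\Psi$ for a channel $W$ is an integer $M\ge 1$ together with inputs $x_1,\dots,x_M$ (not necessarily distinct); its size is $|\Psi|=M$. Put $$\epsilon(\Psi,W_p)=\sum_y\Big|\tfrac1M\sum_{i=1}^M W_{x_i}(y)-W_p(y)\Big|,\qquad D(\Psi,W_p)=D\Big(\tfrac1M\sum_{i=1}^M W_{x_i}\Big\|W_p\Big),$$ where $D(P\|Q)=\sum_y P(y)\log\frac{P(y)}{Q(y)}\in[0,\infty]$, and, for real $M\ge1$, $$\epsilon(M,W)=\sup_{p\in\mathcal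 P(\mathcal X)}\inf_{\Psi:|\Psi|\le M}\epsilon(\Psi,W_p),\qquad D(M,W)=\sup_{p\in\mathcal P(\mathcal X)}\inf_{\Psi:|\Psi|\le M}D(\Psi,W_p).$$ For $R\ge 0$ define the exponents, with values in $[-\infty,\infty]$ (where $-\log 0=\infty$, $-\log\infty=-\infty$), $$e_\epsilon(R|W,p)=\sup_{\{\Psi_n\}}\Big\{\liminf_{n\to\infty}\tfrac{-1}{n}\log\epsilon(\Psi_n,W^n_{p^n})\;\Big|\;\limsup_{n\to\infty}\tfrac1n\log|\Psi_n|\le R\Big\},$$ $$e_D(R|W,p)=\sup_{\{\Psi_n\}}\Big\{\liminf_{n\to\infty}\tfrac{-1}{n}\log D(\Psi_n,W^n_{p^n})\;\Big|\;\limsup_{n\to\infty}\tfrac1n\log|\Psi_n|\le R\Big\},$$ $$e_\epsilon(R|W)=\liminf_{n\to\infty}\tfrac{-1}{n}\log\epsilon(e^{nR},W^n),\qquad e_D(R|W)=\liminf_{n\to\infty}\tfrac{-1}{n}\log D(e^{nR},W^n),$$ where the suprema are over sequences of codes $\Psi_n$ for $W^n$. Let $\mathrm E_p$ be the expectation over $x\sim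 p$ and $$\psi(s|W,p)=\log \mathrm E_p\sum_y W_x(y)^{1+s}W_p(y)^{-s},\qquad \phi(t|W,p)=\log\sum_y\big(\mathrm E_p W_x(y)^{1/(1+t)}\big)^{1+t},$$ $$\psi(s|W)=\log\sup_{p\in\mathcal P(\mathcal X)}\sum_y\big(\mathrm E_pW_x(y)^{1+s}\big)^{1-s},$$ where outputs $y$ with $W_p(y)=0$ contribute $0$ to the sums (in particular $0^0=0$ in the last sum when $s=1$). Then for every $R\ge0$ and every $p\in\mathcal P(\mathcal X)$ the following maxima exist and $$e_\epsilon(R|W,p)\ \ge\ \max_{0\le s\le1}\frac{-\psi(s|W,p)+sR}{1+s},\qquad e_D(R|W,p)\ \ge\ \max_{-1/2\le t\le0}\big\{-\phi(t|W,p)-tR\big\},$$ $$e_\epsilon(R|W)\ \ge\ \max_{0\le s\le1}\frac{-\psi(s|W)+sR}{1+s},\qquad e_D(R|W)\ \ge\ \max_{-1/2\le t\le0}\Big\{-\sup_{p\in\mathcal P(\mathcal X)}\phi(t|W,p)-tR\Big\}.$$ -/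

import Mathlib

open Filter
open scoped ENNReal BigOperators

noncomputable section

namespace Resolvability

/-! ### Channels, product distributions and memoryless extensions -/

theorem tsum_prod_eq_one {α : Type*} :
    ∀ {n : ℕ} (μ : Fin n → PMF α), ∑' a : Fin n → α, ∏ i, μ i (a i) = 1
  | 0, _ => by simp
  | n + 1, μ => by
    rw [← (Fin.consEquiv (fun _ : Fin (n + 1) => α)).tsum_eq, ENNReal.tsum_prod']
    simp only [Fin.consEquiv, Equiv.coe_fn_mk, Fin.prod_univ_succ, Fin.cons_zero, Fin.cons_succ,
      ENNReal.tsum_mul_left, tsum_prod_eq_one (fun i : Fin n => μ i.succ), mul_one, (μ 0).tsum_coe]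

/-- The product of probability distributions `μ 0, …, μ (n - 1)` on `α`, a distribution on `αⁿ`. -/
def prodPMF {α : Type*} {n : ℕ} (μ : Fin n → PMF α) : PMF (Fin n → α) :=
  ⟨fun a => ∏ i, μ i (a i), tsum_prod_eq_one μ ▸ ENNReal.summable.hasSum⟩

/-- The `n`-fold independent and identical distribution `pⁿ` of `p`. -/
def iidPMF {X : Type*} (p : PMF X) (n : ℕ) : PMF (Fin n → X) :=
  prodPMF fun _ => p

/-- The stationary memoryless extension `Wⁿ` of the channel `W`:
`Wⁿ_x (y) = ∏ i, W_{x i} (y i)`. A channel from `X` to `Y` is a map `x ↦ W_x` from `X` to the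
probability distributions on `Y`. -/
def memoryless {X Y : Type*} (W : X → PMF Y) (n : ℕ) : (Fin n → X) → PMF (Fin n → Y) :=
  fun x => prodPMF fun i => W (x i)

/-- The output distribution `W_p (y) = ∑ x, p x * W_x (y)`. -/
def outputDist {X Y : Type*} (W : X → PMF Y) (p : PMF X) : PMF Y :=
  p.bind W

/-! ### Distances between distributions on a finite set -/

/-- The variational distance `d(P, Q) = ∑ y, |P y - Q y|`. -/
def varDist {Y : Type*} [Fintype Y] (P Q : PMF Y) : ℝ :=
  ∑ y, |(P y).toReal - (Q y).toReal|

open Classical in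
/-- The Kullback-Leibler divergence `D(P‖Q) = ∑ y, P y * log (P y / Q y)` (natural logarithm,
terms with `P y = 0` vanish), which is `∞` if `P y > 0 = Q y` for some `y`. The finite sum is
nonnegative for probability distributions with `P ≪ Q`. -/
def klDist {Y : Type*} [Fintype Y] (P Q : PMF Y) : ℝ≥0∞ :=
  if ∀ y, Q y = 0 → P y = 0 then
    ENNReal.ofReal (∑ y, (P y).toReal * Real.log ((P y).toReal / (Q y).toReal))
  else ∞

/-! ### Resolvability codes -/

/-- A resolvability code: a positive integer `M` and `M` (not necessarily distinct) inputs. -/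
structure Code (X : Type*) where
  size : ℕ
  size_pos : 0 < size
  point : Fin size → X

/-- The input distribution `∑ i, (1 / M) 1_{x i}` (an `M`-type) of a resolvability code. -/
def Code.inputDist {X : Type*} (Ψ : Code X) : PMF X :=
  haveI : Nonempty (Fin Ψ.size) := ⟨⟨0, Ψ.size_pos⟩⟩
  (PMF.uniformOfFintype (Fin Ψ.size)).map Ψ.point

/-- `ε(Ψ, W_p)`, the variational distance between the output distribution of the code and `W_p`;
an extended nonnegative number, so that its logarithm and suprema make sense. -/
def codeEps {X Y : Type*} [Fintype Y] (W : X → PMF Y) (Ψ : Code X) (p : PMF X) : ℝ≥0∞ :=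
  ENNReal.ofReal (varDist (outputDist W Ψ.inputDist) (outputDist W p))

/-- `D(Ψ, W_p)`, the divergence of the output distribution of the code from `W_p`. -/
def codeDiv {X Y : Type*} [Fintype Y] (W : X → PMF Y) (Ψ : Code X) (p : PMF X) : ℝ≥0∞ :=
  klDist (outputDist W Ψ.inputDist) (outputDist W p)

/-- `ε(M, W)`: worst input distribution, best code of size at most `M`. -/
def worstEps {X Y : Type*} [Fintype Y] (W : X → PMF Y) (M : ℝ) : ℝ≥0∞ :=
  ⨆ p : PMF X, ⨅ (Ψ : Code X) (_ : (Ψ.size : ℝ) ≤ M), codeEps W Ψ p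

/-- `D(M, W)`: worst input distribution, best code of size at most `M`. -/
def worstDiv {X Y : Type*} [Fintype Y] (W : X → PMF Y) (M : ℝ) : ℝ≥0∞ :=
  ⨆ p : PMF X, ⨅ (Ψ : Code X) (_ : (Ψ.size : ℝ) ≤ M), codeDiv W Ψ p

/-! ### Exponents -/

/-- The exponent `liminf (-1 / n) log (a n)`, where `-log 0 = ∞` and `-log ∞ = -∞`. -/
def exponent (a : ℕ → ℝ≥0∞) : EReal :=
  liminf (fun n : ℕ => -ENNReal.log (a n) / (n : EReal)) atTop

/-- The asymptotic rate `limsup (1 / n) log |Ψ n|` of a sequence of codes for `Xⁿ`. -/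
def rate {X : Type*} (Ψ : (n : ℕ) → Code (Fin n → X)) : EReal :=
  limsup (fun n : ℕ => ((Real.log ((Ψ n).size : ℝ) / (n : ℝ) : ℝ) : EReal)) atTop

/-- `e_ε(R|W,p)`: the optimal exponent of the variational distance for the input `pⁿ`. -/
def expEps {X Y : Type*} [Fintype Y] (W : X → PMF Y) (p : PMF X) (R : ℝ) : EReal :=
  ⨆ (Ψ : (n : ℕ) → Code (Fin n → X)) (_ : rate Ψ ≤ (R : EReal)),
    exponent fun n => codeEps (memoryless W n) (Ψ n) (iidPMF p n)

/-- `e_D(R|W,p)`: the optimal exponent of the divergence for the input `pⁿ`. -/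
def expDiv {X Y : Type*} [Fintype Y] (W : X → PMF Y) (p : PMF X) (R : ℝ) : EReal :=
  ⨆ (Ψ : (n : ℕ) → Code (Fin n → X)) (_ : rate Ψ ≤ (R : EReal)),
    exponent fun n => codeDiv (memoryless W n) (Ψ n) (iidPMF p n)

/-- `e_ε(R|W)`: the exponent of `ε(e^{nR}, Wⁿ)`. -/
def worstExpEps {X Y : Type*} [Fintype Y] (W : X → PMF Y) (R : ℝ) : EReal :=
  exponent fun n => worstEps (memoryless W n) (Real.exp (n * R))

/-- `e_D(R|W)`: the exponent of `D(e^{nR}, Wⁿ)`. -/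
def worstExpDiv {X Y : Type*} [Fintype Y] (W : X → PMF Y) (R : ℝ) : EReal :=
  exponent fun n => worstDiv (memoryless W n) (Real.exp (n * R))

/-! ### The functions `ψ` and `φ` -/

/-- The expectation `E_p f`; it is used for bounded `f` only, where the series converges. -/
def expect {X : Type*} (p : PMF X) (f : X → ℝ) : ℝ :=
  ∑' x, (p x).toReal * f x

/-- `ψ(s|W,p) = log E_p ∑ y, W_x(y)^{1+s} W_p(y)^{-s}`. Where `W_p(y) = 0`, also `W_x(y) = 0` for
every `x` with `p x > 0`, and such `y` contribute nothing. -/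
def psi {X Y : Type*} [Fintype Y] (W : X → PMF Y) (s : ℝ) (p : PMF X) : ℝ :=
  Real.log (expect p fun x =>
    ∑ y, (W x y).toReal ^ (1 + s) * (outputDist W p y).toReal ^ (-s))

/-- `φ(t|W,p) = log ∑ y, (E_p W_x(y)^{1/(1+t)})^{1+t}`. -/
def phi {X Y : Type*} [Fintype Y] (W : X → PMF Y) (t : ℝ) (p : PMF X) : ℝ :=
  Real.log (∑ y, (expect p fun x => (W x y).toReal ^ (1 / (1 + t))) ^ (1 + t))

open Classical in
/-- `∑ y, (E_p W_x(y)^{1+s})^{1-s}`. Outputs `y` of probability `0` under `W_p` contribute `0`, also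
for `s = 1`, so that the expression is continuous in `s` on `[0, 1]`. -/
def gal {X Y : Type*} [Fintype Y] (W : X → PMF Y) (s : ℝ) (p : PMF X) : ℝ :=
  ∑ y, if outputDist W p y = 0 then 0
    else (expect p fun x => (W x y).toReal ^ (1 + s)) ^ (1 - s)

/-- `ψ(s|W) = log max_p ∑ y, (E_p W_x(y)^{1+s})^{1-s}`; the maximum is a supremum when the input
alphabet is infinite, and the expression is at most the number of outputs. -/
def psiMax {X Y : Type*} [Fintype Y] (W : X → PMF Y) (s : ℝ) : ℝ :=
  Real.log (⨆ p : PMF X, gal W s p)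

/-- `max_p φ(t|W,p)`; the maximum is a supremum when the input alphabet is infinite, and the
expression is at most the logarithm of the number of outputs. -/
def phiMax {X Y : Type*} [Fintype Y] (W : X → PMF Y) (t : ℝ) : ℝ :=
  ⨆ p : PMF X, phi W t p

theorem expect_mem {X : Type*} (p : PMF X) {f : X → ℝ} (hf : ∀ x, f x ∈ Set.Icc (0:ℝ) 1) :
    expect p f ∈ Set.Icc (0 : ℝ) 1 := by
  have hs : Summable fun x => (p x).toReal := ENNReal.summable_toReal p.tsum_coe_ne_top
  have h1 : ∑' x, (p x).toReal = 1 := by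
    rw [← ENNReal.tsum_toReal_eq p.apply_ne_top, p.tsum_coe, ENNReal.toReal_one]
  have hle : ∀ x, (p x).toReal * f x ≤ (p x).toReal := fun x =>
    mul_le_of_le_one_right ENNReal.toReal_nonneg (hf x).2
  have h0 : ∀ x, 0 ≤ (p x).toReal * f x := fun x => mul_nonneg ENNReal.toReal_nonneg (hf x).1
  refine ⟨tsum_nonneg h0, ?_⟩
  rw [← h1]
  exact (Summable.of_nonneg_of_le h0 hle hs).tsum_le_tsum hle hs

theorem prob_rpow_mem {Y : Type*} (P : PMF Y) (y : Y) {a : ℝ} (ha : 0 ≤ a) :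
    (P y).toReal ^ a ∈ Set.Icc (0 : ℝ) 1 :=
  ⟨Real.rpow_nonneg ENNReal.toReal_nonneg a, Real.rpow_le_one ENNReal.toReal_nonneg
    (ENNReal.toReal_le_of_le_ofReal zero_le_one (by simpa using P.coe_le_one y)) ha⟩

/-- The supremum defining `psiMax` is over a set that is bounded above. -/
theorem gal_le {X Y : Type*} [Fintype Y] (W : X → PMF Y) {s : ℝ} (hs : s ∈ Set.Icc (0 : ℝ) 1)
    (p : PMF X) : gal W s p ≤ Fintype.card Y := by
  classical
  unfold gal
  calc _ ≤ ∑ _y : Y, (1 : ℝ) := by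
        refine Finset.sum_le_sum fun y _ => ?_
        have h := expect_mem p fun x => prob_rpow_mem (W x) y (by linarith [hs.1] : 0 ≤ 1 + s)
        split_ifs
        · exact zero_le_one
        · exact Real.rpow_le_one h.1 h.2 (by linarith [hs.2])
    _ = _ := by simp

/-- The supremum defining `phiMax` is over a set that is bounded above. -/
theorem phi_le {X Y : Type*} [Fintype Y] (W : X → PMF Y) {t : ℝ} (ht : t ∈ Set.Icc (-1 / 2 : ℝ) 0)
    (p : PMF X) : phi W t p ≤ Real.log (Fintype.card Y) := by
  have ht' : 0 < 1 + t := by linarith [ht.1]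
  have hn : ∀ y, expect p (fun x => (W x y).toReal ^ (1 / (1 + t))) ∈ Set.Icc (0:ℝ) 1 := fun y =>
    expect_mem p fun x => prob_rpow_mem (W x) y (by positivity)
  have hsum : ∑ y, (expect p fun x => (W x y).toReal ^ (1 / (1 + t))) ^ (1 + t)
      ≤ Fintype.card Y := by
    calc _ ≤ ∑ _y : Y, (1 : ℝ) :=
          Finset.sum_le_sum fun y _ => Real.rpow_le_one (hn y).1 (hn y).2 ht'.le
      _ = _ := by simp
  have h0 : 0 ≤ ∑ y, (expect p fun x => (W x y).toReal ^ (1 / (1 + t))) ^ (1 + t) :=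
    Finset.sum_nonneg fun y _ => Real.rpow_nonneg (hn y).1 _
  unfold phi
  rcases h0.eq_or_lt with h | h
  · rw [← h, Real.log_zero]; exact Real.log_natCast_nonneg _
  · exact Real.log_le_log h hsum

end Resolvability

end

/-! Everything rests on a one-shot bound. Write v for `W_p`, q for the output law of a code of size
M, and T for `tilted W s p`, whose logarithm is ψ(s|W,p). For 0 ≤ s ≤ 1 some code has ∑ v^(-s) |q -
v|^(1+s) ≤ 8 T M^(-s). No random code is drawn: the inputs are picked one after another
(`exists_points`). By `abs_add_rpow_le`, adding a deviation b to the sum a of the earlier ones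
raises |a|^(1+s) by at most a term linear in b plus 4 |b|^(1+s). The linear term has mean zero under
p, so some input raises the weighted sum by at most 8 T.

This weighted moment controls both distances (`exists_code`): Jensen's inequality with weights v
bounds the (1+s)-th power of the variational distance, and `mul_log_div_le` bounds the divergence at
the price of a factor 4/s.

For i.i.d. inputs T is multiplicative (`tilted_iid`). For arbitrary inputs on Xⁿ, T is at most ∑ (E
W^a)^b with b = 1 - s and a = 1 + s (`tilted_le_gal`) or a = 1/(1-s) (`tilted_le_powSum`, which
gives φ at t = -s). Such a sum for Wⁿ is at most the n-th power of any one-letter bound that is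
uniform in the input distribution (`powSum_memoryless_le`). Taking M = ⌊exp(nR)⌋, all constants
vanish in the exponent.

The factor 4/s excludes t = 0 in the divergence bounds; that endpoint is a limit. The maxima exist
by continuity on compact intervals or, with a supremum over p, by upper semicontinuity. -/

noncomputable section

namespace Resolvability

/-! ### Real inequalities -/

/-- The signed power `u ↦ ±|u| ^ s`, a subgradient of `u ↦ |u| ^ (1 + s) / (1 + s)`. -/
def signedPow (s u : ℝ) : ℝ := if 0 ≤ u then |u| ^ s else -|u| ^ s

theorem abs_signedPow (s u : ℝ) : |signedPow s u| = |u| ^ s := by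
  have := Real.rpow_nonneg (abs_nonneg u) s
  unfold signedPow
  split_ifs <;> simp [abs_of_nonneg this]

theorem signedPow_mul_self {s : ℝ} (hs : 0 ≤ s) (u : ℝ) : signedPow s u * u = |u| ^ (1 + s) := by
  rw [Real.rpow_add_of_nonneg (abs_nonneg u) zero_le_one hs, Real.rpow_one]
  unfold signedPow
  split_ifs with h
  · rw [abs_of_nonneg h]; ring
  · rw [abs_of_neg (not_le.1 h)]; ring

/-- Convexity of |·|^(1+s): its graph lies above the tangent at c. Proved by Young's inequality with
weights s/(1+s) and 1/(1+s). -/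
theorem abs_rpow_tangent_le {s : ℝ} (hs : 0 ≤ s) (c a : ℝ) :
    |c| ^ (1 + s) + (1 + s) * signedPow s c * (a - c) ≤ |a| ^ (1 + s) := by
  have hs1 : 0 < 1 + s := by linarith
  have key : (1 + s) * (signedPow s c * a) ≤ |a| ^ (1 + s) + s * |c| ^ (1 + s) := by
    have h1 : signedPow s c * a ≤ |c| ^ s * |a| := by
      rw [← abs_signedPow, ← abs_mul]; exact le_abs_self _
    have h2 := Real.geom_mean_le_arith_mean2_weighted (w₁ := s / (1 + s)) (w₂ := 1 / (1 + s))
      (p₁ := |c| ^ (1 + s)) (p₂ := |a| ^ (1 + s)) (by positivity) (by positivity) (by positivity)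
      (by positivity) (by field_simp; ring)
    rw [← Real.rpow_mul (abs_nonneg _), ← Real.rpow_mul (abs_nonneg _),
      mul_div_cancel₀ _ hs1.ne', mul_div_cancel₀ _ hs1.ne', Real.rpow_one] at h2
    calc _ ≤ (1 + s) * (s / (1 + s) * |c| ^ (1 + s) + 1 / (1 + s) * |a| ^ (1 + s)) :=
          mul_le_mul_of_nonneg_left (h1.trans h2) hs1.le
      _ = _ := by field_simp; ring
  have := signedPow_mul_self hs c
  nlinarith

theorem abs_rpow_sub_rpow_le {s : ℝ} (hs : s ∈ Set.Icc (0 : ℝ) 1) {u v : ℝ} (hu : 0 ≤ u)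
    (hv : 0 ≤ v) : |u ^ s - v ^ s| ≤ |u - v| ^ s := by
  wlog h : v ≤ u generalizing u v
  · rw [abs_sub_comm, abs_sub_comm u]; exact this hv hu (le_of_not_ge h)
  rw [abs_of_nonneg (sub_nonneg.2 (Real.rpow_le_rpow hv h hs.1)), abs_of_nonneg (sub_nonneg.2 h)]
  have := Real.rpow_add_le_add_rpow hv (sub_nonneg.2 h) hs.1 hs.2
  rw [add_sub_cancel] at this
  linarith

/-- For equal signs this is subadditivity of the s-th power. For opposite signs |u| and |v| are both
at most |u - v|, hence the factor 2. -/
theorem abs_signedPow_sub_le {s : ℝ} (hs : s ∈ Set.Icc (0 : ℝ) 1) (u v : ℝ) :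
    |signedPow s u - signedPow s v| ≤ 2 * |u - v| ^ s := by
  have h0 := Real.rpow_nonneg (abs_nonneg (u - v)) s
  have hopp : |u| ≤ |u - v| → |v| ≤ |u - v| → |signedPow s u - signedPow s v| ≤ 2 * |u - v| ^ s := by
    intro h1 h2
    have := abs_sub (signedPow s u) (signedPow s v)
    rw [abs_signedPow, abs_signedPow] at this
    linarith [Real.rpow_le_rpow (abs_nonneg _) h1 hs.1, Real.rpow_le_rpow (abs_nonneg _) h2 hs.1]
  rcases le_or_gt 0 u with hu | hu <;> rcases le_or_gt 0 v with hv | hv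
  · have := abs_rpow_sub_rpow_le hs hu hv
    simp only [signedPow, if_pos hu, if_pos hv, abs_of_nonneg hu, abs_of_nonneg hv]
    linarith
  · apply hopp
    · rw [abs_of_nonneg hu, abs_of_nonneg (by linarith : 0 ≤ u - v)]; linarith
    · rw [abs_of_neg hv, abs_of_nonneg (by linarith : 0 ≤ u - v)]; linarith
  · apply hopp
    · rw [abs_of_neg hu, abs_of_neg (by linarith : u - v < 0)]; linarith
    · rw [abs_of_nonneg hv, abs_of_neg (by linarith : u - v < 0)]; linarith
  · have := abs_rpow_sub_rpow_le hs (neg_pos.2 hu).le (neg_pos.2 hv).le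
    simp only [signedPow, if_neg (not_le.2 hu), if_neg (not_le.2 hv), abs_of_neg hu, abs_of_neg hv]
    rw [show -u - -v = -(u - v) by ring, abs_neg] at this
    rw [show -(-u) ^ s - -(-v) ^ s = -((-u) ^ s - (-v) ^ s) by ring, abs_neg]
    linarith

/-- The pointwise inequality behind the von Bahr-Esseen moment bound. -/
theorem abs_add_rpow_le {s : ℝ} (hs : s ∈ Set.Icc (0 : ℝ) 1) (a b : ℝ) :
    |a + b| ^ (1 + s) ≤ |a| ^ (1 + s) + (1 + s) * signedPow s a * b + 4 * |b| ^ (1 + s) := by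
  -- The tangent is taken at a + b and evaluated at a; moving its slope back to a costs 2|b|^s, and
  -- (1 + s) * 2 ≤ 4.
  have h1 := abs_rpow_tangent_le hs.1 (a + b) a
  have h2 := abs_signedPow_sub_le hs (a + b) a
  rw [add_sub_cancel_left] at h2
  have h3 : (signedPow s (a + b) - signedPow s a) * b ≤ 2 * |b| ^ (1 + s) := by
    calc _ ≤ |signedPow s (a + b) - signedPow s a| * |b| := by
          rw [← abs_mul]; exact le_abs_self _
      _ ≤ 2 * |b| ^ s * |b| := mul_le_mul_of_nonneg_right h2 (abs_nonneg b)
      _ = _ := by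
          rw [Real.rpow_add_of_nonneg (abs_nonneg b) zero_le_one hs.1, Real.rpow_one]; ring
  have h4 := Real.rpow_nonneg (abs_nonneg b) (1 + s)
  have h5 := mul_le_mul_of_nonneg_left h3 (by linarith [hs.1] : 0 ≤ 1 + s)
  nlinarith [hs.2]

theorem abs_sub_rpow_le {s u v : ℝ} (hs : 0 ≤ s) (hu : 0 ≤ u) (hv : 0 ≤ v) :
    |u - v| ^ s ≤ u ^ s + v ^ s := by
  have h1 := Real.rpow_nonneg hu s
  have h2 := Real.rpow_nonneg hv s
  rcases le_total u v with h | h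
  · linarith [Real.rpow_le_rpow (abs_nonneg (u - v))
      (show |u - v| ≤ v by rw [abs_of_nonpos] <;> linarith) hs]
  · linarith [Real.rpow_le_rpow (abs_nonneg (u - v))
      (show |u - v| ≤ u by rw [abs_of_nonneg] <;> linarith) hs]

/-- Near 1 the left side is at most (r - 1)², which is below |r - 1|^(1+s) as long as |r - 1| ≤ 1.
For r > 2 the logarithm is at most r^s / s, and r ≤ 2|r - 1| costs 2^(1+s) ≤ 4. -/
theorem mul_log_sub_add_one_le {s : ℝ} (hs : 0 < s) (hs1 : s ≤ 1) {r : ℝ} (hr : 0 ≤ r) :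
    r * Real.log r - r + 1 ≤ 4 / s * |r - 1| ^ (1 + s) := by
  have hs4 : 1 ≤ 4 / s := by rw [le_div_iff₀ hs]; linarith
  rcases hr.eq_or_lt with rfl | hr0
  · simpa using hs4
  rcases le_or_gt r 2 with h2 | h2
  · have habs : |r - 1| ≤ 1 := abs_le.2 ⟨by linarith, by linarith⟩
    have h1 : r * Real.log r - r + 1 ≤ |r - 1| ^ (2 : ℝ) := by
      rw [Real.rpow_two, sq_abs]
      nlinarith [mul_le_mul_of_nonneg_left (Real.log_le_sub_one_of_pos hr0) hr]
    have h3 : |r - 1| ^ (2 : ℝ) ≤ |r - 1| ^ (1 + s) :=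
      Real.rpow_le_rpow_of_exponent_ge_of_imp (abs_nonneg _) habs (by linarith)
        (fun _ h => by linarith)
    exact (h1.trans h3).trans
      (le_mul_of_one_le_left (Real.rpow_nonneg (abs_nonneg (r - 1)) (1 + s)) hs4)
  · have hd : r ≤ 2 * |r - 1| := by rw [abs_of_nonneg] <;> linarith
    have h1 : Real.log r ≤ r ^ s / s := Real.log_le_rpow_div hr hs
    have h3 : r * r ^ s = r ^ (1 + s) := by
      rw [Real.rpow_add hr0, Real.rpow_one]
    have h4 : r ^ (1 + s) ≤ 4 * |r - 1| ^ (1 + s) := by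
      refine (Real.rpow_le_rpow hr hd (by linarith)).trans ?_
      rw [Real.mul_rpow zero_le_two (abs_nonneg _)]
      refine mul_le_mul_of_nonneg_right ?_ (Real.rpow_nonneg (abs_nonneg _) _)
      calc (2 : ℝ) ^ (1 + s) ≤ 2 ^ (2 : ℝ) :=
            Real.rpow_le_rpow_of_exponent_le one_le_two (by linarith)
        _ = 4 := by norm_num
    calc r * Real.log r - r + 1 ≤ r * (r ^ s / s) := by
          nlinarith [mul_le_mul_of_nonneg_left h1 hr]
      _ = r ^ (1 + s) / s := by rw [← h3]; ring
      _ ≤ 4 * |r - 1| ^ (1 + s) / s := by gcongr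
      _ = _ := by ring

/-- The previous bound at r = u / v, scaled by v. The correction -u + v sums to zero over two
probability distributions. -/
theorem mul_log_div_le {s : ℝ} (hs : 0 < s) (hs1 : s ≤ 1) {u v : ℝ} (hu : 0 ≤ u) (hv : 0 < v) :
    u * Real.log (u / v) - u + v ≤ 4 / s * (v ^ (-s) * |u - v| ^ (1 + s)) := by
  have h := mul_le_mul_of_nonneg_left
    (mul_log_sub_add_one_le hs hs1 (div_nonneg hu hv.le)) hv.le
  have h1 : |u / v - 1| = |u - v| / v := by
    rw [div_sub_one hv.ne', abs_div, abs_of_pos hv]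
  have h2 : v * (|u / v - 1| ^ (1 + s)) = v ^ (-s) * |u - v| ^ (1 + s) := by
    rw [h1, Real.div_rpow (abs_nonneg _) hv.le, Real.rpow_add hv, Real.rpow_one, Real.rpow_neg hv.le]
    field_simp
  calc u * Real.log (u / v) - u + v = v * (u / v * Real.log (u / v) - u / v + 1) := by
        field_simp
    _ ≤ v * (4 / s * |u / v - 1| ^ (1 + s)) := h
    _ = _ := by rw [← h2]; ring

/-! ### Moments of a channel -/

theorem _root_.HasSum.of_eq {α : Type*} {f g : α → ℝ} {a b : ℝ} (h : HasSum f a)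
    (hfg : ∀ x, g x = f x) (hab : b = a) : HasSum g b := by
  rwa [hab, funext hfg]

/-- The moment `E_p W_x(y) ^ a`. -/
def moment {X Y : Type*} (W : X → PMF Y) (a : ℝ) (p : PMF X) (y : Y) : ℝ≥0∞ :=
  ∑' x, p x * W x y ^ a

/-- `∑ y, E_p W_x(y) ^ (1 + s) * W_p(y) ^ (-s)`, the exponential of `psi W s p`. -/
def tilted {X Y : Type*} [Fintype Y] (W : X → PMF Y) (s : ℝ) (p : PMF X) : ℝ :=
  ∑ y, (moment W (1 + s) p y).toReal * (outputDist W p y).toReal ^ (-s)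

section Moments

variable {X Y : Type*} (W : X → PMF Y) (p : PMF X)

theorem moment_one (y : Y) : moment W 1 p y = outputDist W p y := by
  simp [moment, outputDist, PMF.bind_apply]

theorem moment_le_one {a : ℝ} (ha : 0 ≤ a) (y : Y) : moment W a p y ≤ 1 := by
  rw [← p.tsum_coe]
  exact ENNReal.tsum_le_tsum fun x =>
    mul_le_of_le_one_right' (ENNReal.rpow_le_one (PMF.coe_le_one _ _) ha)

theorem moment_ne_top {a : ℝ} (ha : 0 ≤ a) (y : Y) : moment W a p y ≠ ∞ :=
  ((moment_le_one W p ha y).trans_lt ENNReal.one_lt_top).ne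

theorem moment_eq_zero_iff {a : ℝ} (ha : 0 < a) (y : Y) :
    moment W a p y = 0 ↔ outputDist W p y = 0 := by
  simp [moment, outputDist, PMF.bind_apply, ENNReal.tsum_eq_zero, ENNReal.rpow_eq_zero_iff, ha,
    not_lt.2 ha.le]

theorem moment_anti {a b : ℝ} (h : a ≤ b) (y : Y) : moment W b p y ≤ moment W a p y :=
  ENNReal.tsum_le_tsum fun _ =>
    mul_le_mul_right (ENNReal.rpow_le_rpow_of_exponent_ge (PMF.coe_le_one _ _) h) _

variable {W p} in
theorem eq_zero_of_outputDist_eq_zero {x : X} {y : Y} (hx : p x ≠ 0)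
    (hy : outputDist W p y = 0) : W x y = 0 := by
  rw [outputDist, PMF.bind_apply, ENNReal.tsum_eq_zero] at hy
  exact (mul_eq_zero.1 (hy x)).resolve_left hx

theorem hasSum_moment {a : ℝ} (ha : 0 ≤ a) (y : Y) :
    HasSum (fun x => (p x).toReal * (W x y).toReal ^ a) (moment W a p y).toReal := by
  have := ENNReal.hasSum_toReal (f := fun x => p x * W x y ^ a) (moment_ne_top W p ha y)
  simpa [ENNReal.toReal_mul, ENNReal.toReal_rpow, moment,
    ENNReal.tsum_toReal_eq (fun x => ENNReal.ne_top_of_tsum_ne_top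
      (moment_ne_top W p ha y) x)] using this

theorem hasSum_prob : HasSum (fun x => (p x).toReal) 1 := by
  have := ENNReal.hasSum_toReal p.tsum_coe_ne_top
  rwa [← ENNReal.tsum_toReal_eq p.apply_ne_top, p.tsum_coe, ENNReal.toReal_one] at this

theorem hasSum_output (y : Y) :
    HasSum (fun x => (p x).toReal * (W x y).toReal) (outputDist W p y).toReal := by
  simpa [moment_one] using hasSum_moment W p zero_le_one y

theorem expect_rpow {a : ℝ} (ha : 0 ≤ a) (y : Y) :
    expect p (fun x => (W x y).toReal ^ a) = (moment W a p y).toReal :=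
  (hasSum_moment W p ha y).tsum_eq

variable {p} in
/-- Some input of positive probability has at most the average value. -/
theorem exists_le_of_hasSum {f : X → ℝ} {v : ℝ}
    (h : HasSum (fun x => (p x).toReal * f x) v) : ∃ x, p x ≠ 0 ∧ f x ≤ v := by
  by_contra! hc
  have h0 : HasSum (fun x => (p x).toReal * (f x - v)) 0 := by
    simpa [mul_sub] using h.sub ((hasSum_prob p).mul_right v)
  have hnn : ∀ x, 0 ≤ (p x).toReal * (f x - v) := fun x => by
    by_cases hx : p x = 0
    · simp [hx]
    · exact mul_nonneg ENNReal.toReal_nonneg (sub_nonneg.2 (hc x hx).le)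
  have hz := (hasSum_zero_iff_of_nonneg hnn).1 h0
  obtain ⟨x, hx⟩ := p.support_nonempty
  rw [PMF.mem_support_iff] at hx
  have hpos : 0 < (p x).toReal * (f x - v) :=
    mul_pos (ENNReal.toReal_pos hx (p.apply_ne_top x)) (sub_pos.2 (hc x hx))
  exact hpos.ne' (congrFun hz x)

/-- Jensen's inequality: average the tangent inequality at the mean v, where the linear term
cancels. -/
theorem output_rpow_le_moment {s : ℝ} (hs : 0 ≤ s) (y : Y) :
    (outputDist W p y).toReal ^ (1 + s) ≤ (moment W (1 + s) p y).toReal := by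
  set v := (outputDist W p y).toReal with hv
  have hv0 : 0 ≤ v := ENNReal.toReal_nonneg
  have h1 : HasSum (fun x => (p x).toReal * (v ^ (1 + s) + (1 + s) * signedPow s v *
      ((W x y).toReal - v))) (v ^ (1 + s)) := by
    have := ((hasSum_prob p).mul_right (v ^ (1 + s) - (1 + s) * signedPow s v * v)).add
      ((hasSum_output W p y).mul_right ((1 + s) * signedPow s v))
    exact this.of_eq (fun x => by ring) (by rw [← hv]; ring)
  refine hasSum_le (fun x => mul_le_mul_of_nonneg_left ?_ ENNReal.toReal_nonneg) h1
    (hasSum_moment W p (by linarith) y)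
  have := abs_rpow_tangent_le hs v (W x y).toReal
  rwa [abs_of_nonneg hv0, abs_of_nonneg ENNReal.toReal_nonneg] at this

/-- Hölder's inequality for moments. -/
theorem moment_one_add_le {s : ℝ} (hs : 0 ≤ s) (hs1 : s < 1) (y : Y) :
    (moment W (1 + s) p y).toReal ≤
      (outputDist W p y).toReal ^ s * (moment W (1 / (1 - s)) p y).toReal ^ (1 - s) := by
  have h1 : 0 < 1 - s := by linarith
  have ha : 0 < 1 / (1 - s) := by positivity
  by_cases h0 : outputDist W p y = 0
  · rw [(moment_eq_zero_iff W p (by linarith : 0 < 1 + s) y).2 h0]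
    simp only [ENNReal.toReal_zero]
    exact mul_nonneg (Real.rpow_nonneg ENNReal.toReal_nonneg _)
      (Real.rpow_nonneg ENNReal.toReal_nonneg _)
  have hv : 0 < (outputDist W p y).toReal := ENNReal.toReal_pos h0 (PMF.apply_ne_top _ _)
  have hm : 0 < (moment W (1 / (1 - s)) p y).toReal :=
    ENNReal.toReal_pos (fun h => h0 ((moment_eq_zero_iff W p ha y).1 h))
      (moment_ne_top W p ha.le y)
  set v := (outputDist W p y).toReal with hvdef
  set m := (moment W (1 / (1 - s)) p y).toReal with hmdef
  -- C is the target bound. Weighted AM-GM is applied to the normalized values w / v and w^(1/(1-s))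
  -- / m, each of mean 1.
  set C := v ^ s * m ^ (1 - s) with hC
  have hC0 : 0 < C := mul_pos (Real.rpow_pos_of_pos hv _) (Real.rpow_pos_of_pos hm _)
  have hsum : HasSum (fun x => (p x).toReal * (C * (s * ((W x y).toReal / v) +
      (1 - s) * ((W x y).toReal ^ (1 / (1 - s)) / m)))) C := by
    refine (((hasSum_output W p y).mul_right (C * s / v)).add
      ((hasSum_moment W p ha.le y).mul_right (C * (1 - s) / m))).of_eq (fun x => by ring) ?_
    rw [← hvdef, ← hmdef]
    field_simp
    ring
  refine hasSum_le (fun x => mul_le_mul_of_nonneg_left ?_ ENNReal.toReal_nonneg)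
    (hasSum_moment W p (by linarith) y) hsum
  have hw : 0 ≤ (W x y).toReal := ENNReal.toReal_nonneg
  have h2 := Real.geom_mean_le_arith_mean2_weighted hs h1.le (div_nonneg hw hv.le)
    (div_nonneg (Real.rpow_nonneg hw (1 / (1 - s))) hm.le) (by ring)
  calc _ = C * (((W x y).toReal / v) ^ s *
        ((W x y).toReal ^ (1 / (1 - s)) / m) ^ (1 - s)) := by
        rw [Real.div_rpow hw hv.le, Real.div_rpow (Real.rpow_nonneg hw _) hm.le,
          ← Real.rpow_mul hw, one_div_mul_cancel h1.ne', Real.rpow_one, add_comm 1 s,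
          Real.rpow_add_of_nonneg hw hs zero_le_one, Real.rpow_one, hC]
        have := Real.rpow_pos_of_pos hv s
        have := Real.rpow_pos_of_pos hm (1 - s)
        field_simp
    _ ≤ _ := mul_le_mul_of_nonneg_left h2 hC0.le

theorem prob_sum_toReal [Fintype Y] (P : PMF Y) : ∑ y, (P y).toReal = 1 := by
  rw [← ENNReal.toReal_sum fun y _ => P.apply_ne_top y, ← tsum_fintype (L := .unconditional _),
    P.tsum_coe, ENNReal.toReal_one]

/-- By Jensen each term is at least `W_p(y)`. It makes `tilted` positive, so that its logarithm can
be undone. -/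
theorem one_le_tilted [Fintype Y] {s : ℝ} (hs : 0 ≤ s) : 1 ≤ tilted W s p := by
  rw [← prob_sum_toReal (outputDist W p)]
  refine Finset.sum_le_sum fun y _ => ?_
  have h := output_rpow_le_moment W p hs y
  rcases (ENNReal.toReal_nonneg (a := outputDist W p y)).eq_or_lt with h0 | h0
  · rw [← h0] at h ⊢
    exact mul_nonneg ENNReal.toReal_nonneg (Real.rpow_nonneg le_rfl _)
  · refine le_trans (le_of_eq ?_) (mul_le_mul_of_nonneg_right h (Real.rpow_nonneg h0.le _))
    rw [← Real.rpow_add h0, add_neg_cancel_right, Real.rpow_one]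

/-- Inputs whose output laws deviate little from `W_p` on average, in the weighted moment of order
`1 + s`; they are chosen one after another. -/
theorem exists_points [Fintype Y] {s : ℝ} (hs : s ∈ Set.Icc (0 : ℝ) 1) (M : ℕ) :
    ∃ x : Fin M → X, (∀ i, p (x i) ≠ 0) ∧
      ∑ y, (outputDist W p y).toReal ^ (-s) *
        |∑ i, ((W (x i) y).toReal - (outputDist W p y).toReal)| ^ (1 + s)
        ≤ M * (8 * tilted W s p) := by
  have hs1 : 0 ≤ 1 + s := by linarith [hs.1]
  have hs1' : 1 + s ≠ 0 := by linarith [hs.1]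
  induction M with
  | zero => exact ⟨Fin.elim0, fun i => i.elim0, by simp [Real.zero_rpow hs1']⟩
  | succ M ih =>
    obtain ⟨x, hx, hΦ⟩ := ih
    set v : Y → ℝ := fun y => (outputDist W p y).toReal with hv
    set w : Y → ℝ := fun y => v y ^ (-s) with hw
    have hw0 : ∀ y, 0 ≤ w y := fun y => Real.rpow_nonneg ENNReal.toReal_nonneg _
    set S : Y → ℝ := fun y => ∑ i, ((W (x i) y).toReal - v y) with hS
    set c : Y → ℝ := fun y => (1 + s) * signedPow s (S y) with hc
    set m : Y → ℝ := fun y => (moment W (1 + s) p y).toReal with hm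
    -- The mean increment over z ~ p: the term with `c y` drops out because `W z y` has mean `v y`.
    have hsum : HasSum (fun z => (p z).toReal * ∑ y, w y * (c y * ((W z y).toReal - v y) +
        4 * ((W z y).toReal ^ (1 + s) + v y ^ (1 + s))))
        (∑ y, w y * (4 * (m y + v y ^ (1 + s)))) := by
      simp_rw [Finset.mul_sum]
      refine hasSum_sum fun y _ => ?_
      have := (((hasSum_output W p y).mul_right (w y * c y)).add
        ((hasSum_moment W p hs1 y).mul_right (w y * 4))).add
        ((hasSum_prob p).mul_right (w y * (4 * v y ^ (1 + s) - c y * v y)))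
      exact this.of_eq (fun z => by simp only [hv]; ring) (by simp only [hm, hv]; ring)
    obtain ⟨z, hz, hle⟩ := exists_le_of_hasSum hsum
    refine ⟨Fin.cons z x, fun i => Fin.cases hz hx i, ?_⟩
    have hstep : ∀ y, w y * |∑ i, ((W ((Fin.cons z x : Fin (M + 1) → X) i) y).toReal - v y)| ^ (1 + s)
        ≤ w y * |S y| ^ (1 + s) + w y * (c y * ((W z y).toReal - v y) +
        4 * ((W z y).toReal ^ (1 + s) + v y ^ (1 + s))) := fun y => by
      rw [Fin.sum_univ_succ, ← mul_add]
      simp only [Fin.cons_zero, Fin.cons_succ]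
      rw [add_comm]
      refine mul_le_mul_of_nonneg_left ?_ (hw0 y)
      have h1 := abs_add_rpow_le hs (S y) ((W z y).toReal - v y)
      have h2 := abs_sub_rpow_le hs1 (ENNReal.toReal_nonneg (a := W z y))
        (ENNReal.toReal_nonneg (a := outputDist W p y))
      linarith
    -- By Jensen v^(1+s) ≤ m, so 4 (m + v^(1+s)) ≤ 8 m.
    have hmean : ∑ y, w y * (4 * (m y + v y ^ (1 + s))) ≤ 8 * tilted W s p := by
      rw [tilted, Finset.mul_sum]
      refine Finset.sum_le_sum fun y _ => ?_
      have := mul_le_mul_of_nonneg_left (output_rpow_le_moment W p hs.1 y) (hw0 y)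
      simp only [hm, hw, hv] at this ⊢
      linarith
    calc _ ≤ _ := Finset.sum_le_sum fun y _ => hstep y
      _ ≤ M * (8 * tilted W s p) + 8 * tilted W s p := by
        rw [Finset.sum_add_distrib]; exact add_le_add hΦ (hle.trans hmean)
      _ = _ := by push_cast; ring

end Moments

/-! ### Codes -/

theorem Code.outputDist_toReal {X Y : Type*} (W : X → PMF Y) (Ψ : Code X) (y : Y) :
    (outputDist W Ψ.inputDist y).toReal = (∑ i, (W (Ψ.point i) y).toReal) / Ψ.size := by
  have : Nonempty (Fin Ψ.size) := ⟨⟨0, Ψ.size_pos⟩⟩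
  rw [outputDist, Code.inputDist, PMF.bind_map, PMF.bind_apply, tsum_fintype,
    ENNReal.toReal_sum fun i _ => ENNReal.mul_ne_top (PMF.apply_ne_top _ _) (PMF.apply_ne_top _ _),
    Finset.sum_div]
  refine Finset.sum_congr rfl fun i _ => ?_
  simp [ENNReal.toReal_mul, PMF.uniformOfFintype_apply]
  ring

/-- One-shot achievability: a code of each size `M` that is good for the variational distance, and
for the divergence. -/
theorem exists_code {X Y : Type*} [Fintype Y] (W : X → PMF Y) (p : PMF X) {s : ℝ}
    (hs : s ∈ Set.Icc (0 : ℝ) 1) {M : ℕ} (hM : 0 < M) :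
    ∃ Ψ : Code X, Ψ.size = M ∧
      codeEps W Ψ p ≤ ENNReal.ofReal ((8 * tilted W s p * (M : ℝ) ^ (-s)) ^ (1 / (1 + s))) ∧
      (0 < s → codeDiv W Ψ p ≤ ENNReal.ofReal (4 / s * (8 * tilted W s p * (M : ℝ) ^ (-s)))) := by
  have hs1 : 0 < 1 + s := by linarith [hs.1]
  have hM' : (0 : ℝ) < M := by exact_mod_cast hM
  obtain ⟨x, hx, hΦ⟩ := exists_points W p hs M
  refine ⟨⟨M, hM, x⟩, rfl, ?_⟩
  set Ψ : Code X := ⟨M, hM, x⟩ with hΨ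
  set v : Y → ℝ := fun y => (outputDist W p y).toReal with hv
  set q : Y → ℝ := fun y => (outputDist W Ψ.inputDist y).toReal with hq
  have hv0 : ∀ y, 0 ≤ v y := fun y => ENNReal.toReal_nonneg
  have hq0 : ∀ y, 0 ≤ q y := fun y => ENNReal.toReal_nonneg
  have hqv : ∀ y, q y - v y = (∑ i, ((W (x i) y).toReal - v y)) / M := fun y => by
    simp only [hq, Code.outputDist_toReal, hΨ, Finset.sum_sub_distrib, Finset.sum_const,
      Finset.card_univ, Fintype.card_fin, nsmul_eq_mul]
    field_simp
  -- The chosen inputs have positive probability, so the code's output law is absolutely continuous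
  -- with respect to `W_p`.
  have hzero : ∀ y, v y = 0 → q y = 0 := fun y hy => by
    have hy' : outputDist W p y = 0 :=
      ((ENNReal.toReal_eq_zero_iff _).1 hy).resolve_right (PMF.apply_ne_top _ _)
    simp [hq, Code.outputDist_toReal, hΨ, eq_zero_of_outputDist_eq_zero (hx _) hy']
  set B := 8 * tilted W s p * (M : ℝ) ^ (-s) with hB
  have hΦ' : ∑ y, v y ^ (-s) * |q y - v y| ^ (1 + s) ≤ B := by
    calc _ = (∑ y, v y ^ (-s) * |∑ i, ((W (x i) y).toReal - v y)| ^ (1 + s)) / M ^ (1 + s) := by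
          rw [Finset.sum_div]
          refine Finset.sum_congr rfl fun y _ => ?_
          rw [hqv, abs_div, abs_of_pos hM', Real.div_rpow (abs_nonneg _) hM'.le, mul_div_assoc]
      _ ≤ M * (8 * tilted W s p) / M ^ (1 + s) := by gcongr
      _ = B := by
          rw [hB, Real.rpow_add hM', Real.rpow_one, Real.rpow_neg hM'.le]
          field_simp
  constructor
  · refine ENNReal.ofReal_le_ofReal ?_
    have h1 : varDist (outputDist W Ψ.inputDist) (outputDist W p) =
        ∑ y, v y * (|q y - v y| / v y) := Finset.sum_congr rfl fun y _ => by
      rcases eq_or_ne (v y) 0 with h | h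
      · have h' := hzero y h
        simp only [hv, hq] at h h'
        simp [hv, h, h']
      · rw [mul_div_cancel₀ _ h]
    -- Jensen with weights v for the ratio |q - v| / v.
    have h2 := Real.rpow_arith_mean_le_arith_mean_rpow Finset.univ v (fun y => |q y - v y| / v y)
      (fun y _ => hv0 y) (prob_sum_toReal _) (fun y _ => div_nonneg (abs_nonneg _) (hv0 y))
      (by linarith [hs.1] : 1 ≤ 1 + s)
    rw [← h1] at h2
    have h0 : 0 ≤ varDist (outputDist W Ψ.inputDist) (outputDist W p) :=
      Finset.sum_nonneg fun y _ => abs_nonneg _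
    have h3 : ∑ y, v y * (|q y - v y| / v y) ^ (1 + s) =
        ∑ y, v y ^ (-s) * |q y - v y| ^ (1 + s) := Finset.sum_congr rfl fun y _ => by
      rcases (hv0 y).eq_or_lt with h | h
      · rw [hzero y h.symm, ← h]
        simp [Real.zero_rpow hs1.ne']
      · rw [Real.div_rpow (abs_nonneg _) h.le, Real.rpow_add h, Real.rpow_one, Real.rpow_neg h.le]
        field_simp
    have hB0 : 0 ≤ B := le_trans (Real.rpow_nonneg h0 _) (h2.trans (h3.le.trans hΦ'))
    rw [one_div, Real.le_rpow_inv_iff_of_pos h0 hB0 hs1]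
    exact h2.trans (h3.le.trans hΦ')
  · intro hs0
    rw [codeDiv, klDist, if_pos]
    · refine ENNReal.ofReal_le_ofReal ?_
      -- Both laws have total mass 1, so the added terms cancel and a termwise bound becomes
      -- possible.
      calc _ = ∑ y, (q y * Real.log (q y / v y) - q y + v y) := by
            rw [Finset.sum_add_distrib, Finset.sum_sub_distrib, prob_sum_toReal, prob_sum_toReal]
            ring
        _ ≤ ∑ y, 4 / s * (v y ^ (-s) * |q y - v y| ^ (1 + s)) := by
            refine Finset.sum_le_sum fun y _ => ?_
            rcases (hv0 y).eq_or_lt with h | h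
            · rw [hzero y h.symm, ← h]
              simp [Real.zero_rpow hs1.ne']
            · exact mul_log_div_le hs0 hs.2 (hq0 y) h
        _ ≤ _ := by
            rw [← Finset.mul_sum]
            exact mul_le_mul_of_nonneg_left hΦ' (by positivity)
    · intro y hy
      have := hzero y (by simp [hv, hy])
      exact ((ENNReal.toReal_eq_zero_iff _).1 this).resolve_right (PMF.apply_ne_top _ _)

/-! ### Sums of powers of moments -/

/-- The power `u ^ b`, but `0` at `u = 0`, also for `b = 0`. -/
def powZero (b : ℝ) (u : ℝ≥0∞) : ℝ≥0∞ := if u = 0 then 0 else u ^ b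

/-- `∑ y, (E_p W_x(y) ^ a) ^ b`, where `0 ^ b` counts as `0`. -/
def powSum {X Y : Type*} [Fintype Y] (W : X → PMF Y) (a b : ℝ) (p : PMF X) : ℝ≥0∞ :=
  ∑ y, powZero b (moment W a p y)

theorem powZero_mul {b : ℝ} (hb : 0 ≤ b) (u v : ℝ≥0∞) :
    powZero b (u * v) = powZero b u * powZero b v := by
  by_cases hu : u = 0
  · simp [powZero, hu]
  by_cases hv : v = 0
  · simp [powZero, hv]
  simp [powZero, hu, hv, ENNReal.mul_rpow_of_nonneg _ _ hb]

theorem powZero_ne_top {b : ℝ} (hb : 0 ≤ b) {u : ℝ≥0∞} (hu : u ≠ ∞) : powZero b u ≠ ∞ := by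
  unfold powZero
  split_ifs
  · exact ENNReal.zero_ne_top
  · exact ENNReal.rpow_ne_top_of_nonneg hb hu

theorem powZero_toReal (b : ℝ) (u : ℝ≥0∞) :
    (powZero b u).toReal = if u = 0 then 0 else u.toReal ^ b := by
  unfold powZero
  split_ifs <;> simp [ENNReal.toReal_rpow]

section OneLetter

variable {X Y : Type*} [Fintype Y] (W : X → PMF Y) (p : PMF X)

theorem powSum_ne_top {a b : ℝ} (ha : 0 ≤ a) (hb : 0 ≤ b) : powSum W a b p ≠ ∞ :=
  ENNReal.sum_ne_top.2 fun y _ => powZero_ne_top hb (moment_ne_top W p ha y)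

theorem powSum_toReal {a b : ℝ} (ha : 0 ≤ a) (hb : 0 ≤ b) :
    (powSum W a b p).toReal = ∑ y, (powZero b (moment W a p y)).toReal :=
  ENNReal.toReal_sum fun y _ => powZero_ne_top hb (moment_ne_top W p ha y)

theorem gal_eq {s : ℝ} (hs : s ∈ Set.Icc (0 : ℝ) 1) :
    gal W s p = (powSum W (1 + s) (1 - s) p).toReal := by
  have h1 : 0 < 1 + s := by linarith [hs.1]
  rw [powSum_toReal W p h1.le (by linarith [hs.2]), gal]
  refine Finset.sum_congr rfl fun y _ => ?_
  simp only [powZero_toReal, moment_eq_zero_iff W p h1, expect_rpow W p h1.le]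

theorem phi_eq {t : ℝ} (ht : -1 < t) :
    phi W t p = Real.log (powSum W (1 / (1 + t)) (1 + t) p).toReal := by
  have h1 : 0 < 1 + t := by linarith
  rw [powSum_toReal W p (by positivity) h1.le, phi]
  congr 1
  refine Finset.sum_congr rfl fun y _ => ?_
  rw [powZero_toReal, expect_rpow W p (by positivity)]
  split_ifs with h
  · rw [h, ENNReal.toReal_zero, Real.zero_rpow h1.ne']
  · rfl

theorem psi_eq {s : ℝ} (hs : 0 ≤ s) : psi W s p = Real.log (tilted W s p) := by
  unfold psi tilted expect
  congr 1
  simp_rw [Finset.mul_sum]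
  refine HasSum.tsum_eq (hasSum_sum fun y _ => ?_)
  exact ((hasSum_moment W p (by linarith) y).mul_right _).of_eq (fun x => by ring) rfl

/-- As `W_x(y) ≤ 1`, the moment m of order 1 + s is at most `W_p(y)`; hence m W_p^(-s) ≤ m · m^(-s)
= m^(1-s). -/
theorem tilted_le_gal {s : ℝ} (hs : s ∈ Set.Icc (0 : ℝ) 1) : tilted W s p ≤ gal W s p := by
  have h1 : 0 < 1 + s := by linarith [hs.1]
  rw [gal_eq W p hs, powSum_toReal W p h1.le (by linarith [hs.2])]
  refine Finset.sum_le_sum fun y _ => ?_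
  rw [powZero_toReal]
  split_ifs with h
  · simp [h]
  have hm : 0 < (moment W (1 + s) p y).toReal := ENNReal.toReal_pos h (moment_ne_top W p h1.le y)
  have hle : (moment W (1 + s) p y).toReal ≤ (outputDist W p y).toReal :=
    ENNReal.toReal_mono (PMF.apply_ne_top _ _)
      (moment_one W p y ▸ moment_anti W p (by linarith [hs.1]) y)
  calc _ ≤ (moment W (1 + s) p y).toReal * (moment W (1 + s) p y).toReal ^ (-s) :=
        mul_le_mul_of_nonneg_left (Real.rpow_le_rpow_of_nonpos hm hle (by linarith [hs.1])) hm.le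
    _ = _ := by rw [sub_eq_add_neg, Real.rpow_add hm, Real.rpow_one]

/-- Hölder's inequality `moment_one_add_le` produces a factor W_p^s, which cancels the weight
W_p^(-s). -/
theorem tilted_le_powSum {s : ℝ} (hs : 0 ≤ s) (hs1 : s < 1) :
    tilted W s p ≤ (powSum W (1 / (1 - s)) (1 - s) p).toReal := by
  have h1 : 0 < 1 - s := by linarith
  have ha : 0 < 1 / (1 - s) := by positivity
  rw [powSum_toReal W p ha.le h1.le]
  refine Finset.sum_le_sum fun y _ => ?_
  rw [powZero_toReal]
  split_ifs with h
  · rw [(moment_eq_zero_iff W p (by linarith) y).2 ((moment_eq_zero_iff W p ha y).1 h)]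
    simp
  have hv : 0 < (outputDist W p y).toReal := ENNReal.toReal_pos
    (fun h0 => h ((moment_eq_zero_iff W p ha y).2 h0)) (PMF.apply_ne_top _ _)
  have h2 := mul_le_mul_of_nonneg_right (moment_one_add_le W p hs hs1 y)
    (Real.rpow_nonneg hv.le (-s))
  refine h2.trans_eq ?_
  rw [mul_right_comm, ← Real.rpow_add hv, add_neg_cancel, Real.rpow_zero, one_mul]

/-- The moment is at most v = W_p(y), and ∑ v^(1-s) ≤ N^s for N outputs, by weighted AM-GM of v with
the uniform law. It shows that φ(-s) is O(s) uniformly in p. -/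
theorem powSum_le_card_rpow [Nonempty Y] {s : ℝ} (hs : 0 ≤ s) (hs1 : s < 1) :
    (powSum W (1 / (1 - s)) (1 - s) p).toReal ≤ (Fintype.card Y : ℝ) ^ s := by
  have h1 : 0 < 1 - s := by linarith
  have ha : 0 < 1 / (1 - s) := by positivity
  have hN : (0 : ℝ) < Fintype.card Y := by exact_mod_cast Fintype.card_pos
  rw [powSum_toReal W p ha.le h1.le]
  have hterm : ∀ y, (powZero (1 - s) (moment W (1 / (1 - s)) p y)).toReal ≤
      (Fintype.card Y : ℝ) ^ s *
        (s * (1 / (Fintype.card Y : ℝ)) + (1 - s) * (outputDist W p y).toReal) := fun y => by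
    have hv : 0 ≤ (outputDist W p y).toReal := ENNReal.toReal_nonneg
    have hle : (powZero (1 - s) (moment W (1 / (1 - s)) p y)).toReal ≤
        (outputDist W p y).toReal ^ (1 - s) := by
      rw [powZero_toReal]
      split_ifs with h
      · exact Real.rpow_nonneg hv _
      · refine Real.rpow_le_rpow ENNReal.toReal_nonneg (ENNReal.toReal_mono
          (PMF.apply_ne_top _ _) (moment_one W p y ▸ moment_anti W p ?_ y)) h1.le
        rw [le_div_iff₀ h1]; linarith
    refine hle.trans ?_
    have h2 := Real.geom_mean_le_arith_mean2_weighted hs h1.le (one_div_pos.2 hN).le hv (by ring)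
    refine le_trans (le_of_eq ?_) (mul_le_mul_of_nonneg_left h2 (Real.rpow_nonneg hN.le s))
    rw [← mul_assoc, ← Real.mul_rpow hN.le (one_div_pos.2 hN).le, mul_one_div_cancel hN.ne',
      Real.one_rpow, one_mul]
  refine (Finset.sum_le_sum fun y _ => hterm y).trans_eq ?_
  rw [← Finset.mul_sum, Finset.sum_add_distrib, ← Finset.mul_sum, ← Finset.mul_sum,
    prob_sum_toReal, Finset.sum_const, Finset.card_univ, nsmul_eq_mul, mul_one_div_cancel hN.ne']
  ring

end OneLetter

/-! ### Memoryless extensions -/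

theorem tsum_pi_prod {α : Type*} :
    ∀ {n : ℕ} (f : Fin n → α → ℝ≥0∞), ∑' a : Fin n → α, ∏ i, f i (a i) = ∏ i, ∑' x, f i x
  | 0, _ => by simp
  | n + 1, f => by
    rw [← (Fin.consEquiv (fun _ : Fin (n + 1) => α)).tsum_eq, ENNReal.tsum_prod']
    simp only [Fin.consEquiv, Equiv.coe_fn_mk, Fin.prod_univ_succ, Fin.cons_zero, Fin.cons_succ,
      ENNReal.tsum_mul_left, ENNReal.tsum_mul_right, tsum_pi_prod (fun i : Fin n => f i.succ)]

section Memoryless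

variable {X Y : Type*} (W : X → PMF Y)

theorem memoryless_apply (n : ℕ) (x : Fin n → X) (y : Fin n → Y) :
    memoryless W n x y = ∏ i, W (x i) (y i) := rfl

theorem moment_iid {a : ℝ} (ha : 0 ≤ a) (p : PMF X) (n : ℕ) (y : Fin n → Y) :
    moment (memoryless W n) a (iidPMF p n) y = ∏ i, moment W a p (y i) := by
  simp only [moment]
  rw [← tsum_pi_prod fun i x => p x * W x (y i) ^ a]
  refine tsum_congr fun x => ?_
  rw [Finset.prod_mul_distrib, ENNReal.prod_rpow_of_nonneg ha]
  rfl

theorem tilted_iid [Fintype Y] {s : ℝ} (hs : 0 ≤ s) (p : PMF X) (n : ℕ) :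
    tilted (memoryless W n) s (iidPMF p n) = tilted W s p ^ n := by
  rw [tilted, tilted, Fintype.sum_pow]
  refine Finset.sum_congr rfl fun y _ => ?_
  rw [← moment_one, moment_iid W (by linarith), moment_iid W zero_le_one, ENNReal.toReal_prod,
    ENNReal.toReal_prod, ← Real.finsetProd_rpow _ _ fun i _ => ENNReal.toReal_nonneg,
    ← Finset.prod_mul_distrib]
  simp only [moment_one]

/-- Conditioning on the first letter: the moment at `y₀, y` factors into a moment of `W`, for the
first marginal of `p`, and a moment of `Wⁿ` for an input distribution that depends on `y₀`. -/
theorem exists_moment_cons {a : ℝ} (ha : 0 ≤ a) {n : ℕ} (p : PMF (Fin (n + 1) → X)) :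
    ∃ (p₀ : PMF X) (q : Y → PMF (Fin n → X)), ∀ (y₀ : Y) (y : Fin n → Y),
      moment (memoryless W (n + 1)) a p (Fin.cons y₀ y) =
        moment W a p₀ y₀ * moment (memoryless W n) a (q y₀) y := by
  have hp : ∑' x₀, ∑' x : Fin n → X, p (Fin.cons x₀ x) = 1 := by
    rw [← p.tsum_coe, ← (Fin.consEquiv (fun _ : Fin (n + 1) => X)).tsum_eq, ENNReal.tsum_prod']
    rfl
  let p₀ : PMF X := ⟨fun x₀ => ∑' x : Fin n → X, p (Fin.cons x₀ x),
    hp ▸ ENNReal.summable.hasSum⟩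
  -- The unnormalized law of the remaining letters, the first one being weighted by `W x₀ y₀ ^ a`;
  -- its mass is the first-letter moment.
  let f : Y → (Fin n → X) → ℝ≥0∞ := fun y₀ x => ∑' x₀, p (Fin.cons x₀ x) * W x₀ y₀ ^ a
  have hf : ∀ y₀, ∑' x, f y₀ x = moment W a p₀ y₀ := fun y₀ => by
    rw [ENNReal.tsum_comm]
    exact tsum_congr fun x₀ => ENNReal.tsum_mul_right
  have hmom : ∀ (y₀ : Y) (y : Fin n → Y), moment (memoryless W (n + 1)) a p (Fin.cons y₀ y) =
      ∑' x, f y₀ x * memoryless W n x y ^ a := fun y₀ y => by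
    rw [moment, ← (Fin.consEquiv (fun _ : Fin (n + 1) => X)).tsum_eq, ENNReal.tsum_prod',
      ENNReal.tsum_comm]
    refine tsum_congr fun x => ?_
    rw [← ENNReal.tsum_mul_right]
    refine tsum_congr fun x₀ => ?_
    have : memoryless W (n + 1) (Fin.cons x₀ x) (Fin.cons y₀ y) =
        W x₀ y₀ * memoryless W n x y := by
      rw [memoryless_apply, Fin.prod_univ_succ]
      rfl
    change p (Fin.cons x₀ x) * memoryless W (n + 1) (Fin.cons x₀ x) (Fin.cons y₀ y) ^ a = _
    rw [this, ENNReal.mul_rpow_of_nonneg _ _ ha, mul_assoc]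
  have hex : ∀ y₀, ∃ q : PMF (Fin n → X), ∀ y : Fin n → Y,
      moment (memoryless W (n + 1)) a p (Fin.cons y₀ y) =
        moment W a p₀ y₀ * moment (memoryless W n) a q y := fun y₀ => by
    by_cases h0 : moment W a p₀ y₀ = 0
    · obtain ⟨x, -⟩ := p.support_nonempty
      -- Both sides vanish here, so any distribution serves.
      refine ⟨PMF.pure fun i => x i.succ, fun y => ?_⟩
      have hz : ∀ x, f y₀ x = 0 := by
        rw [← ENNReal.tsum_eq_zero, hf, h0]
      simp [hmom, hz, h0]
    · have hT := moment_ne_top W p₀ ha y₀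
      refine ⟨PMF.normalize (f y₀) (by rwa [hf]) (by rwa [hf]), fun y => ?_⟩
      rw [hmom, moment.eq_def (memoryless W n), ← ENNReal.tsum_mul_left]
      refine tsum_congr fun x => ?_
      rw [PMF.normalize_apply, hf]
      calc _ = (moment W a p₀ y₀ * (moment W a p₀ y₀)⁻¹) *
            (f y₀ x * memoryless W n x y ^ a) := by rw [ENNReal.mul_inv_cancel h0 hT, one_mul]
        _ = _ := by ring
  choose q hq using hex
  exact ⟨p₀, q, hq⟩

/-- Induction on n: after conditioning, the law of the remaining letters depends on y₀, but the
induction hypothesis is uniform over input laws, so correlated inputs gain nothing. -/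
theorem powSum_memoryless_le [Fintype Y] {a b : ℝ} (ha : 0 ≤ a) (hb : 0 ≤ b) {G : ℝ≥0∞}
    (hG : ∀ p, powSum W a b p ≤ G) (n : ℕ) (p : PMF (Fin n → X)) :
    powSum (memoryless W n) a b p ≤ G ^ n := by
  induction n with
  | zero =>
    have h1 : ∀ y : Fin 0 → Y, moment (memoryless W 0) a p y = 1 := fun y => by
      rw [← p.tsum_coe]
      refine tsum_congr fun x => ?_
      simp [memoryless_apply]
    simp [powSum, h1, powZero]
  | succ n ih =>
    obtain ⟨p₀, q, h⟩ := exists_moment_cons W ha p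
    rw [powSum, ← (Fin.consEquiv (fun _ : Fin (n + 1) => Y)).sum_comp, Fintype.sum_prod_type]
    calc _ = ∑ y₀, powZero b (moment W a p₀ y₀) * powSum (memoryless W n) a b (q y₀) := by
          refine Finset.sum_congr rfl fun y₀ _ => ?_
          rw [powSum, Finset.mul_sum]
          refine Finset.sum_congr rfl fun y _ => ?_
          rw [← powZero_mul hb, ← h]
          rfl
      _ ≤ ∑ y₀, powZero b (moment W a p₀ y₀) * G ^ n := by gcongr; exact ih _
      _ = powSum W a b p₀ * G ^ n := by rw [← Finset.sum_mul]; rfl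
      _ ≤ G ^ (n + 1) := by rw [pow_succ']; gcongr; exact hG _

end Memoryless

/-! ### Continuity in the parameter and existence of maxima -/

section Continuity

variable {X Y : Type*} (W : X → PMF Y) (p : PMF X)

/-- The series is dominated by `p x`, uniformly in a > 0. -/
theorem continuousOn_moment (y : Y) :
    ContinuousOn (fun a : ℝ => (moment W a p y).toReal) (Set.Ioi 0) := by
  have h : ContinuousOn (fun a : ℝ => ∑' x, (p x).toReal * (W x y).toReal ^ a) (Set.Ioi 0) := by
    refine continuousOn_tsum (fun x => ?_) (hasSum_prob p).summable fun x a ha => ?_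
    · exact continuousOn_const.mul fun a ha =>
        (Real.continuousAt_const_rpow' (ne_of_gt ha)).continuousWithinAt
    · have h1 := prob_rpow_mem (W x) y (le_of_lt ha)
      rw [Real.norm_of_nonneg (mul_nonneg ENNReal.toReal_nonneg h1.1)]
      exact mul_le_of_le_one_right ENNReal.toReal_nonneg h1.2
  exact h.congr fun a ha => (hasSum_moment W p (le_of_lt ha) y).tsum_eq.symm

theorem moment_toReal_pos {a : ℝ} (ha : 0 < a) {y : Y} (hy : outputDist W p y ≠ 0) :
    0 < (moment W a p y).toReal :=
  ENNReal.toReal_pos (fun h => hy ((moment_eq_zero_iff W p ha y).1 h)) (moment_ne_top W p ha.le y)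

/-- Outputs with `W_p(y) = 0` contribute 0 for every parameter and the others have a positive base,
so an outer exponent 0 does no harm. -/
theorem continuousOn_powSum [Fintype Y] {K : Set ℝ} {α β : ℝ → ℝ} (hα : ContinuousOn α K)
    (hβ : ContinuousOn β K) (hα0 : ∀ s ∈ K, 0 < α s) (hβ0 : ∀ s ∈ K, 0 ≤ β s) :
    ContinuousOn (fun s => (powSum W (α s) (β s) p).toReal) K := by
  have h : ContinuousOn (fun s => ∑ y, (powZero (β s) (moment W (α s) p y)).toReal) K := by
    refine continuousOn_finsetSum _ fun y _ => ?_
    by_cases hy : outputDist W p y = 0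
    · refine (continuousOn_const (c := (0 : ℝ))).congr fun s hs => ?_
      rw [powZero_toReal, if_pos ((moment_eq_zero_iff W p (hα0 s hs) y).2 hy)]
    · have h1 : ContinuousOn (fun s => (moment W (α s) p y).toReal ^ β s) K :=
        ((continuousOn_moment W p y).comp hα hα0).rpow hβ fun s hs =>
          Or.inl (moment_toReal_pos W p (hα0 s hs) hy).ne'
      refine h1.congr fun s hs => ?_
      rw [powZero_toReal, if_neg fun h => hy ((moment_eq_zero_iff W p (hα0 s hs) y).1 h)]
  exact h.congr fun s hs => powSum_toReal W p (hα0 s hs).le (hβ0 s hs)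

theorem powSum_toReal_pos [Fintype Y] {a b : ℝ} (ha : 0 < a) (hb : 0 ≤ b) :
    0 < (powSum W a b p).toReal := by
  obtain ⟨y, hy⟩ := (outputDist W p).support_nonempty
  rw [PMF.mem_support_iff] at hy
  rw [powSum_toReal W p ha.le hb]
  refine Finset.sum_pos' (fun y _ => ENNReal.toReal_nonneg) ⟨y, Finset.mem_univ y, ?_⟩
  rw [powZero_toReal, if_neg fun h => hy ((moment_eq_zero_iff W p ha y).1 h)]
  exact Real.rpow_pos_of_pos (moment_toReal_pos W p ha hy) _

theorem continuousOn_tilted [Fintype Y] :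
    ContinuousOn (fun s => tilted W s p) (Set.Icc 0 1) := by
  refine continuousOn_finsetSum _ fun y _ => ?_
  have hpos : ∀ s ∈ Set.Icc (0 : ℝ) 1, 0 < 1 + s := fun s hs => by linarith [hs.1]
  by_cases hy : outputDist W p y = 0
  · refine (continuousOn_const (c := (0 : ℝ))).congr fun s hs => ?_
    simp [(moment_eq_zero_iff W p (hpos s hs) y).2 hy]
  · refine ((continuousOn_moment W p y).comp (by fun_prop) hpos).mul ?_
    exact continuousOn_const.rpow (by fun_prop) fun s _ =>
      Or.inl (ENNReal.toReal_pos hy (PMF.apply_ne_top _ _)).ne'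

/-- The infimum of a family of continuous functions attains its maximum on a compact set. -/
theorem exists_isMaxOn_of_approx {ι : Type*} {K : Set ℝ} (hK : IsCompact K) (hne : K.Nonempty)
    {f : ℝ → ℝ} {g : ι → ℝ → ℝ} (hg : ∀ i, ContinuousOn (g i) K)
    (hle : ∀ i, ∀ s ∈ K, f s ≤ g i s) (happ : ∀ s ∈ K, ∀ c, f s < c → ∃ i, g i s < c) :
    ∃ s ∈ K, IsMaxOn f K s := by
  refine UpperSemicontinuousOn.exists_isMaxOn hne hK fun s hs c hc => ?_
  obtain ⟨i, hi⟩ := happ s hs c hc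
  filter_upwards [(hg i s hs).eventually_lt_const hi, self_mem_nhdsWithin] with z hz hzK
  exact (hle i z hzK).trans_lt hz

end Continuity

theorem isGreatest_image_of_isMaxOn {K : Set ℝ} {f : ℝ → ℝ} {e : EReal}
    (h : ∃ s ∈ K, IsMaxOn f K s) (hle : ∀ s ∈ K, (f s : EReal) ≤ e) :
    ∃ m : ℝ, IsGreatest (f '' K) m ∧ (m : EReal) ≤ e := by
  obtain ⟨s, hs, hmax⟩ := h
  refine ⟨f s, ⟨⟨s, hs, rfl⟩, ?_⟩, hle s hs⟩
  rintro _ ⟨z, hz, rfl⟩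
  exact hmax hz

/-! ### Exponents -/

theorem le_exponent {a : ℕ → ℝ≥0∞} {C m : ℝ} (hC : 0 < C)
    (ha : ∀ n : ℕ, a n ≤ ENNReal.ofReal (C * Real.exp (-(n * m)))) : (m : EReal) ≤ exponent a := by
  have hlim : Tendsto (fun n : ℕ => ((-Real.log C / n + m : ℝ) : EReal)) atTop (nhds (m : EReal)) := by
    refine (continuous_coe_real_ereal.tendsto m).comp ?_
    simpa using (tendsto_const_div_atTop_nhds_zero_nat (-Real.log C)).add_const m
  rw [exponent, ← hlim.liminf_eq]
  refine liminf_le_liminf ?_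
  filter_upwards [eventually_gt_atTop 0] with n hn
  have hn' : (0 : ℝ) < n := by exact_mod_cast hn
  have hlog : ENNReal.log (a n) ≤ ((Real.log C - n * m : ℝ) : EReal) := by
    refine (ENNReal.log_monotone (ha n)).trans_eq ?_
    have hpos : 0 < C * Real.exp (-(n * m)) := mul_pos hC (Real.exp_pos _)
    rw [ENNReal.log_ofReal_of_pos hpos, Real.log_mul hC.ne' (Real.exp_pos _).ne', Real.log_exp]
    rfl
  have h1 : ((-(Real.log C - n * m) : ℝ) : EReal) ≤ -ENNReal.log (a n) := by
    rw [EReal.coe_neg]; exact EReal.neg_le_neg_iff.2 hlog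
  calc ((-Real.log C / n + m : ℝ) : EReal) = ((-(Real.log C - n * m) : ℝ) : EReal) / (n : EReal) := by
        rw [← EReal.coe_natCast, ← EReal.coe_div]
        congr 1
        field_simp
        ring
    _ ≤ _ := EReal.div_le_div_right_of_nonneg (by positivity) h1

/-- Since exp x ≥ 1, its integer part is at least exp x / 2; this costs 2^s ≤ 2. -/
theorem floor_exp_rpow_neg_le {x s : ℝ} (hx : 0 ≤ x) (hs : s ∈ Set.Icc (0 : ℝ) 1) :
    0 < ⌊Real.exp x⌋₊ ∧ (⌊Real.exp x⌋₊ : ℝ) ^ (-s) ≤ 2 * Real.exp (-(s * x)) := by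
  have h1 : 1 ≤ ⌊Real.exp x⌋₊ := Nat.le_floor (by simpa using hx)
  have h2 := Nat.lt_floor_add_one (Real.exp x)
  have h1' : (1 : ℝ) ≤ ⌊Real.exp x⌋₊ := by exact_mod_cast h1
  refine ⟨h1, ?_⟩
  have he := Real.exp_pos x
  calc (⌊Real.exp x⌋₊ : ℝ) ^ (-s) ≤ (2⁻¹ * Real.exp x) ^ (-s) :=
        Real.rpow_le_rpow_of_nonpos (by positivity) (by linarith) (by linarith [hs.1])
    _ = 2 ^ s * Real.exp (-(s * x)) := by
        rw [Real.mul_rpow (by norm_num) he.le, ← Real.exp_mul, Real.inv_rpow zero_le_two,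
          Real.rpow_neg zero_le_two, inv_inv]
        congr 2
        ring
    _ ≤ _ := by
        gcongr
        simpa using Real.rpow_le_rpow_of_exponent_le one_le_two hs.2

/-- One-shot achievability with the size and the moment on an exponential scale. -/
theorem exists_code_exp {X Y : Type*} [Fintype Y] (W : X → PMF Y) (p : PMF X) {s c R : ℝ}
    (hs : s ∈ Set.Icc (0 : ℝ) 1) (hR : 0 ≤ R) {n : ℕ} (h : tilted W s p ≤ Real.exp (n * c)) :
    ∃ Ψ : Code X, (Ψ.size : ℝ) ≤ Real.exp (n * R) ∧
      codeEps W Ψ p ≤ ENNReal.ofReal (16 * Real.exp (-(n * ((-c + s * R) / (1 + s))))) ∧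
      (0 < s → codeDiv W Ψ p ≤ ENNReal.ofReal (64 / s * Real.exp (-(n * (-c + s * R))))) := by
  have hs1 : 0 < 1 + s := by linarith [hs.1]
  obtain ⟨hM, hMs⟩ := floor_exp_rpow_neg_le (mul_nonneg n.cast_nonneg hR : 0 ≤ n * R) hs
  obtain ⟨Ψ, hsize, hε, hD⟩ := exists_code W p hs hM
  have hB0 : 0 ≤ 8 * tilted W s p * (⌊Real.exp (n * R)⌋₊ : ℝ) ^ (-s) := by
    have := one_le_tilted W p hs.1
    positivity
  have hB : 8 * tilted W s p * (⌊Real.exp (n * R)⌋₊ : ℝ) ^ (-s) ≤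
      16 * Real.exp (-(n * (-c + s * R))) := by
    calc _ ≤ 8 * Real.exp (n * c) * (2 * Real.exp (-(s * (n * R)))) := by gcongr
      _ = 16 * (Real.exp (n * c) * Real.exp (-(s * (n * R)))) := by ring
      _ = _ := by rw [← Real.exp_add]; ring_nf
  refine ⟨Ψ, hsize ▸ Nat.floor_le (Real.exp_pos _).le, hε.trans (ENNReal.ofReal_le_ofReal ?_),
    fun h0 => (hD h0).trans (ENNReal.ofReal_le_ofReal ?_)⟩
  · calc _ ≤ (16 * Real.exp (-(n * (-c + s * R)))) ^ (1 / (1 + s)) :=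
          Real.rpow_le_rpow hB0 hB (by positivity)
      _ = 16 ^ (1 / (1 + s)) * Real.exp (-(n * ((-c + s * R) / (1 + s)))) := by
          rw [Real.mul_rpow (by norm_num) (Real.exp_pos _).le, ← Real.exp_mul]
          congr 2
          ring
      _ ≤ _ := by
          gcongr
          have : 1 / (1 + s) ≤ 1 := by rw [div_le_one hs1]; linarith [hs.1]
          simpa using Real.rpow_le_rpow_of_exponent_le (by norm_num : (1 : ℝ) ≤ 16) this
  · calc _ ≤ 4 / s * (16 * Real.exp (-(n * (-c + s * R)))) := by gcongr
      _ = _ := by ring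

section Achievability

variable {X Y : Type*} [Fintype Y] (W : X → PMF Y) {s c R : ℝ}

theorem rate_le {Ψ : (n : ℕ) → Code (Fin n → X)} (hR : 0 ≤ R)
    (h : ∀ n : ℕ, ((Ψ n).size : ℝ) ≤ Real.exp (n * R)) : rate Ψ ≤ (R : EReal) := by
  refine limsup_le_of_le (by isBoundedDefault) (Eventually.of_forall fun n => ?_)
  refine EReal.coe_le_coe_iff.2 (div_le_of_le_mul₀ n.cast_nonneg hR ?_)
  have hpos : (0 : ℝ) < (Ψ n).size := by exact_mod_cast (Ψ n).size_pos
  rw [mul_comm, Real.log_le_iff_le_exp hpos]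
  exact h n

theorem le_expEps (p : PMF X) (hs : s ∈ Set.Icc (0 : ℝ) 1) (hR : 0 ≤ R)
    (h : ∀ n : ℕ, tilted (memoryless W n) s (iidPMF p n) ≤ Real.exp (n * c)) :
    (((-c + s * R) / (1 + s) : ℝ) : EReal) ≤ expEps W p R := by
  choose Ψ hsize hε _ using fun n => exists_code_exp _ _ hs hR (h n)
  exact le_iSup₂_of_le Ψ (rate_le hR hsize) (le_exponent (by norm_num) hε)

theorem le_expDiv (p : PMF X) (hs : s ∈ Set.Icc (0 : ℝ) 1) (hs0 : 0 < s) (hR : 0 ≤ R)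
    (h : ∀ n : ℕ, tilted (memoryless W n) s (iidPMF p n) ≤ Real.exp (n * c)) :
    ((-c + s * R : ℝ) : EReal) ≤ expDiv W p R := by
  choose Ψ hsize _ hD using fun n => exists_code_exp _ _ hs hR (h n)
  exact le_iSup₂_of_le Ψ (rate_le hR hsize) (le_exponent (by positivity) fun n => hD n hs0)

/-- The code may depend on p, but its error bound does not, so the supremum over p is harmless. -/
theorem le_worstExpEps (hs : s ∈ Set.Icc (0 : ℝ) 1) (hR : 0 ≤ R)
    (h : ∀ (n : ℕ) (p : PMF (Fin n → X)), tilted (memoryless W n) s p ≤ Real.exp (n * c)) :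
    (((-c + s * R) / (1 + s) : ℝ) : EReal) ≤ worstExpEps W R := by
  refine le_exponent (C := 16) (by norm_num) fun n => iSup_le fun p => ?_
  obtain ⟨Ψ, hsize, hε, -⟩ := exists_code_exp _ p hs hR (h n p)
  exact iInf₂_le_of_le Ψ hsize hε

theorem le_worstExpDiv (hs : s ∈ Set.Icc (0 : ℝ) 1) (hs0 : 0 < s) (hR : 0 ≤ R)
    (h : ∀ (n : ℕ) (p : PMF (Fin n → X)), tilted (memoryless W n) s p ≤ Real.exp (n * c)) :
    ((-c + s * R : ℝ) : EReal) ≤ worstExpDiv W R := by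
  refine le_exponent (C := 64 / s) (by positivity) fun n => iSup_le fun p => ?_
  obtain ⟨Ψ, hsize, -, hD⟩ := exists_code_exp _ p hs hR (h n p)
  exact iInf₂_le_of_le Ψ hsize (hD hs0)

end Achievability

/-! ### The functions `ψ` and `φ` -/

section PsiPhi

variable {X Y : Type*} [Fintype Y] (W : X → PMF Y)

instance [Nonempty X] : Nonempty (PMF X) := ⟨PMF.pure (Classical.arbitrary X)⟩

theorem exp_psi (p : PMF X) {s : ℝ} (hs : 0 ≤ s) : Real.exp (psi W s p) = tilted W s p := by
  rw [psi_eq W p hs, Real.exp_log (zero_lt_one.trans_le (one_le_tilted W p hs))]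

theorem exp_phi (p : PMF X) {t : ℝ} (ht : -1 < t) :
    Real.exp (phi W t p) = (powSum W (1 / (1 + t)) (1 + t) p).toReal := by
  have h1 : 0 < 1 + t := by linarith
  rw [phi_eq W p ht, Real.exp_log (powSum_toReal_pos W p (by positivity) h1.le)]

theorem gal_pos (p : PMF X) {s : ℝ} (hs : s ∈ Set.Icc (0 : ℝ) 1) : 0 < gal W s p := by
  rw [gal_eq W p hs]
  exact powSum_toReal_pos W p (by linarith [hs.1]) (by linarith [hs.2])

theorem bddAbove_gal {s : ℝ} (hs : s ∈ Set.Icc (0 : ℝ) 1) :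
    BddAbove (Set.range fun p : PMF X => gal W s p) :=
  ⟨Fintype.card Y, by rintro _ ⟨p, rfl⟩; exact gal_le W hs p⟩

theorem bddAbove_phi {t : ℝ} (ht : t ∈ Set.Icc (-1 / 2 : ℝ) 0) :
    BddAbove (Set.range fun p : PMF X => phi W t p) :=
  ⟨Real.log (Fintype.card Y), by rintro _ ⟨p, rfl⟩; exact phi_le W ht p⟩

theorem iSup_gal_pos [Nonempty X] {s : ℝ} (hs : s ∈ Set.Icc (0 : ℝ) 1) :
    0 < ⨆ p : PMF X, gal W s p :=
  (gal_pos W (Classical.arbitrary _) hs).trans_le (le_ciSup (bddAbove_gal W hs) _)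

theorem tilted_iid_le_psi (p : PMF X) {s : ℝ} (hs : 0 ≤ s) (n : ℕ) :
    tilted (memoryless W n) s (iidPMF p n) ≤ Real.exp (n * psi W s p) := by
  rw [tilted_iid W hs, Real.exp_nat_mul, exp_psi W p hs]

theorem tilted_iid_le_phi (p : PMF X) {s : ℝ} (hs : 0 ≤ s) (hs1 : s < 1) (n : ℕ) :
    tilted (memoryless W n) s (iidPMF p n) ≤ Real.exp (n * phi W (-s) p) := by
  rw [tilted_iid W hs, Real.exp_nat_mul, exp_phi W p (by linarith), ← sub_eq_add_neg]
  have := one_le_tilted W p hs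
  gcongr
  exact tilted_le_powSum W p hs hs1

theorem powSum_memoryless_toReal_le {a b c : ℝ} (ha : 0 ≤ a) (hb : 0 ≤ b)
    (h : ∀ p, (powSum W a b p).toReal ≤ Real.exp c) (n : ℕ) (p : PMF (Fin n → X)) :
    (powSum (memoryless W n) a b p).toReal ≤ Real.exp (n * c) := by
  rw [Real.exp_nat_mul]
  refine ENNReal.toReal_le_of_le_ofReal (by positivity) ?_
  rw [ENNReal.ofReal_pow (Real.exp_pos _).le]
  exact powSum_memoryless_le W ha hb (fun p =>
    ENNReal.le_ofReal_iff_toReal_le (powSum_ne_top W p ha hb) (Real.exp_pos _).le |>.2 (h p)) n p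

theorem tilted_memoryless_le_psiMax [Nonempty X] {s : ℝ} (hs : s ∈ Set.Icc (0 : ℝ) 1) (n : ℕ)
    (p : PMF (Fin n → X)) : tilted (memoryless W n) s p ≤ Real.exp (n * psiMax W s) := by
  refine (tilted_le_gal _ p hs).trans ?_
  rw [gal_eq _ p hs]
  refine powSum_memoryless_toReal_le W (by linarith [hs.1]) (by linarith [hs.2]) (fun p => ?_) n p
  rw [← gal_eq W p hs, psiMax, Real.exp_log (iSup_gal_pos W hs)]
  exact le_ciSup (bddAbove_gal W hs) p

theorem tilted_memoryless_le_phiMax {s : ℝ} (hs : s ∈ Set.Icc (0 : ℝ) (1 / 2)) (n : ℕ)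
    (p : PMF (Fin n → X)) : tilted (memoryless W n) s p ≤ Real.exp (n * phiMax W (-s)) := by
  have h1 : 0 < 1 - s := by linarith [hs.2]
  refine (tilted_le_powSum _ p hs.1 (by linarith)).trans ?_
  refine powSum_memoryless_toReal_le W (by positivity) h1.le (fun p => ?_) n p
  rw [sub_eq_add_neg, ← exp_phi W p (by linarith : -1 < -s), Real.exp_le_exp]
  exact le_ciSup (bddAbove_phi W ⟨by linarith [hs.2], by linarith [hs.1]⟩) p

theorem phi_neg_le (p : PMF X) {s : ℝ} (hs : 0 ≤ s) (hs1 : s < 1) :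
    phi W (-s) p ≤ s * Real.log (Fintype.card Y) := by
  obtain ⟨y, -⟩ := (outputDist W p).support_nonempty
  have : Nonempty Y := ⟨y⟩
  have hN : (0 : ℝ) < Fintype.card Y := by exact_mod_cast Fintype.card_pos
  rw [← Real.exp_le_exp, exp_phi W p (by linarith), ← sub_eq_add_neg, mul_comm, Real.exp_mul,
    Real.exp_log hN]
  exact powSum_le_card_rpow W p hs hs1

theorem phi_zero (p : PMF X) : phi W 0 p = 0 := by
  rw [phi]
  simp only [add_zero, div_one, Real.rpow_one]
  have h : ∀ y, expect p (fun x => (W x y).toReal) = (outputDist W p y).toReal :=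
    fun y => (hasSum_output W p y).tsum_eq
  simp only [h, prob_sum_toReal, Real.log_one]

/-! ### Continuity of the objectives and existence of the four maxima -/

theorem continuousOn_gal (p : PMF X) : ContinuousOn (fun s => gal W s p) (Set.Icc 0 1) :=
  (continuousOn_powSum W p (α := fun s => 1 + s) (β := fun s => 1 - s) (by fun_prop)
    (by fun_prop) (fun s hs => by linarith [hs.1]) fun s hs => by linarith [hs.2]).congr
    fun _ hs => gal_eq W p hs

theorem continuousOn_psi (p : PMF X) : ContinuousOn (fun s => psi W s p) (Set.Icc 0 1) :=
  ((continuousOn_tilted W p).log fun _ hs =>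
    (zero_lt_one.trans_le (one_le_tilted W p hs.1)).ne').congr fun _ hs => psi_eq W p hs.1

theorem continuousOn_phi (p : PMF X) :
    ContinuousOn (fun t => phi W t p) (Set.Icc (-1 / 2) 0) := by
  have hpos : ∀ t ∈ Set.Icc (-1 / 2 : ℝ) 0, 0 < 1 + t := fun t ht => by linarith [ht.1]
  have h : ContinuousOn (fun t => (powSum W (1 / (1 + t)) (1 + t) p).toReal)
      (Set.Icc (-1 / 2) 0) :=
    continuousOn_powSum W p (continuousOn_const.div (by fun_prop) fun t ht => (hpos t ht).ne')
      (by fun_prop) (fun t ht => one_div_pos.2 (hpos t ht)) fun t ht => (hpos t ht).le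
  exact (h.log fun t ht => (powSum_toReal_pos W p (one_div_pos.2 (hpos t ht))
    (hpos t ht).le).ne').congr fun t ht => phi_eq W p (by linarith [hpos t ht])

theorem exists_isMaxOn_psi (p : PMF X) (R : ℝ) :
    ∃ s ∈ Set.Icc (0 : ℝ) 1,
      IsMaxOn (fun s => (-psi W s p + s * R) / (1 + s)) (Set.Icc 0 1) s :=
  isCompact_Icc.exists_isMaxOn ⟨0, by norm_num⟩ <|
    ((continuousOn_psi W p).neg.add (by fun_prop)).div (by fun_prop)
      fun s hs => by linarith [hs.1]

theorem exists_isMaxOn_phi (p : PMF X) (R : ℝ) :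
    ∃ t ∈ Set.Icc (-1 / 2 : ℝ) 0, IsMaxOn (fun t => -phi W t p - t * R) (Set.Icc (-1 / 2) 0) t :=
  isCompact_Icc.exists_isMaxOn ⟨0, by norm_num⟩ <| (continuousOn_phi W p).neg.sub (by fun_prop)

theorem exists_isMaxOn_psiMax [Nonempty X] (R : ℝ) :
    ∃ s ∈ Set.Icc (0 : ℝ) 1,
      IsMaxOn (fun s => (-psiMax W s + s * R) / (1 + s)) (Set.Icc 0 1) s := by
  have hpos : ∀ s ∈ Set.Icc (0 : ℝ) 1, 0 < 1 + s := fun s hs => by linarith [hs.1]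
  -- The supremum over p enters with a minus sign, so the objective is an infimum of continuous
  -- functions.
  refine exists_isMaxOn_of_approx isCompact_Icc ⟨0, by norm_num⟩
    (g := fun p s => (-Real.log (gal W s p) + s * R) / (1 + s)) (fun p => ?_) (fun p s hs => ?_)
    fun s hs c hc => ?_
  · exact (((continuousOn_gal W p).log fun s hs => (gal_pos W p hs).ne').neg.add
      (by fun_prop)).div (by fun_prop) fun s hs => (hpos s hs).ne'
  · have h1 := Real.log_le_log (gal_pos W p hs) (le_ciSup (bddAbove_gal W hs) p)
    have := hpos s hs
    rw [psiMax]
    gcongr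
  · rw [div_lt_iff₀ (hpos s hs)] at hc
    have h1 : s * R - c * (1 + s) < psiMax W s := by linarith
    rw [psiMax, Real.lt_log_iff_exp_lt (iSup_gal_pos W hs)] at h1
    obtain ⟨p, hp⟩ := exists_lt_of_lt_ciSup h1
    rw [← Real.lt_log_iff_exp_lt (gal_pos W p hs)] at hp
    refine ⟨p, ?_⟩
    rw [div_lt_iff₀ (hpos s hs)]
    linarith

theorem exists_isMaxOn_phiMax [Nonempty X] (R : ℝ) :
    ∃ t ∈ Set.Icc (-1 / 2 : ℝ) 0,
      IsMaxOn (fun t => -phiMax W t - t * R) (Set.Icc (-1 / 2) 0) t := by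
  refine exists_isMaxOn_of_approx isCompact_Icc ⟨0, by norm_num⟩
    (g := fun p t => -phi W t p - t * R) (fun p => (continuousOn_phi W p).neg.sub (by fun_prop))
    (fun p t ht => ?_) fun t ht c hc => ?_
  · have : phi W t p ≤ phiMax W t := le_ciSup (bddAbove_phi W ht) p
    linarith
  · have h1 : -c - t * R < phiMax W t := by linarith
    obtain ⟨p, hp⟩ := exists_lt_of_lt_ciSup h1
    exact ⟨p, by linarith⟩

end PsiPhi

/-- A lower bound with the parameter `-s`, `0 < s ≤ 1 / 2`, extends to the parameter `0`. -/
theorem le_of_forall_neg {f : ℝ → ℝ} {e : EReal} {L R : ℝ} (hR : 0 ≤ R) (hf0 : f 0 = 0)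
    (hfL : ∀ s, 0 ≤ s → s ≤ 1 / 2 → f (-s) ≤ s * L)
    (h : ∀ s, 0 < s → s ≤ 1 / 2 → ((-f (-s) + s * R : ℝ) : EReal) ≤ e) :
    ∀ t ∈ Set.Icc (-1 / 2 : ℝ) 0, ((-f t - t * R : ℝ) : EReal) ≤ e := by
  intro t ht
  rcases ht.2.lt_or_eq with h0 | rfl
  · have := h (-t) (by linarith) (by linarith [ht.1])
    rwa [neg_neg, neg_mul, ← sub_eq_add_neg] at this
  -- At t = 0 the claim is 0 ≤ e: the bounds at -s are at least -(s * L), which tends to 0.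
  have hlim : Tendsto (fun s : ℝ => ((-(s * L) : ℝ) : EReal)) (nhdsWithin 0 (Set.Ioi 0))
      (nhds ((-f 0 - 0 * R : ℝ) : EReal)) := by
    refine (continuous_coe_real_ereal.tendsto _).comp ?_
    have : Continuous fun s : ℝ => -(s * L) := by fun_prop
    have h1 := (this.tendsto 0).mono_left (nhdsWithin_le_nhds (s := Set.Ioi 0))
    simpa [hf0] using h1
  refine le_of_tendsto hlim ?_
  filter_upwards [Ioc_mem_nhdsGT (show (0 : ℝ) < 1 / 2 by norm_num)] with s hs
  refine le_trans (EReal.coe_le_coe_iff.2 ?_) (h s hs.1 hs.2)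
  have := hfL s hs.1.le hs.2
  have := mul_nonneg hs.1.le hR
  linarith

end Resolvability

end

/-! ### The four bounds -/

open Resolvability in
theorem theorem5 {X Y : Type*} [Nonempty X] [Fintype Y] (W : X → PMF Y) (R : ℝ) (hR : 0 ≤ R) :
    (∀ p : PMF X,
      (∃ m : ℝ, IsGreatest ((fun s : ℝ => (-psi W s p + s * R) / (1 + s)) '' Set.Icc 0 1) m ∧
        (m : EReal) ≤ expEps W p R) ∧
      (∃ m : ℝ, IsGreatest ((fun t : ℝ => -phi W t p - t * R) '' Set.Icc (-1 / 2) 0) m ∧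
        (m : EReal) ≤ expDiv W p R)) ∧
    (∃ m : ℝ, IsGreatest ((fun s : ℝ => (-psiMax W s + s * R) / (1 + s)) '' Set.Icc 0 1) m ∧
      (m : EReal) ≤ worstExpEps W R) ∧
    (∃ m : ℝ, IsGreatest ((fun t : ℝ => -phiMax W t - t * R) '' Set.Icc (-1 / 2) 0) m ∧
      (m : EReal) ≤ worstExpDiv W R) := by
  have hmem : ∀ s : ℝ, 0 < s → s ≤ 1 / 2 → s ∈ Set.Icc (0 : ℝ) 1 :=
    fun s h0 h1 => ⟨h0.le, by linarith⟩
  refine ⟨fun p => ⟨?_, ?_⟩, ?_, ?_⟩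
  · exact isGreatest_image_of_isMaxOn (exists_isMaxOn_psi W p R) fun s hs =>
      le_expEps W p hs hR (tilted_iid_le_psi W p hs.1)
  · exact isGreatest_image_of_isMaxOn (exists_isMaxOn_phi W p R) <|
      le_of_forall_neg (f := fun t => phi W t p) hR (phi_zero W p)
        (fun s h0 h1 => phi_neg_le W p h0 (by linarith)) fun s h0 h1 =>
        le_expDiv W p (hmem s h0 h1) h0 hR (tilted_iid_le_phi W p h0.le (by linarith))
  · exact isGreatest_image_of_isMaxOn (exists_isMaxOn_psiMax W R) fun s hs =>
      le_worstExpEps W hs hR (tilted_memoryless_le_psiMax W hs)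
  · exact isGreatest_image_of_isMaxOn (exists_isMaxOn_phiMax W R) <|
      le_of_forall_neg (f := phiMax W) hR (by simp [phiMax, phi_zero])
        (fun s h0 h1 => ciSup_le fun p => phi_neg_le W p h0 (by linarith)) fun s h0 h1 =>
        le_worstExpDiv W (hmem s h0 h1) h0 hR (tilted_memoryless_le_phiMax W ⟨h0.le, h1⟩)
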